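/- **Setting.** Let $\mathcal G$ be a locally compact Hausdorff groupoid with continuous structure maps (range $r$, domain $d$, composition, inversion), with unit space $\mathcal G^{(0)}$ and Haar system $\nu=\{\nu^x\}_{x\in\mathcal G^{(0)}}$ (Radon measures with $\operatorname{supp}\nu^x=r^{-1}(x)$, left invariant, and such that $x\mapsto\int f\,d\nu^x$ is continuous for $f\in C_c(\mathcal G)$). Then $C_c(\mathcal G)$ is a $*$-algebra for $f*g(\eta)=\int f(\xi)g(\xi^{-1}\eta)\,d\nu^{r(\eta)}(\xi)$ and $f^*(\xi)=\overline{f(\xi^{-1})}$. Let $$\|f\|_I=\max\Big\{\sup_x\int|f(\xi)|\,d\nu^x(\xi),\ \sup_x\int|f(\xi^{-1})|\,d\nu^x(\xi)\Big\}.$$ The full $C^*$-algebra $C^*(\mathcal G)$ is the completion of $C_c(\mathcal G)$ in the norm $\sup_\pi\|\pi(f)\|$, where $\pi$ runs over the $*$-representations of $C_c(\mathcal G)$ on Hilbert spaces with $\|\pi(f)\|\le\|f\|_I$ that are continuous from the inductive limit topology to the weak operator topology. The reduced $C^*$-algebra $C^*_r(\mathcal G)$ is the completion of $C_c(\mathcal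 G)$ in the operator norm of $\Phi\mapsto f*\Phi$ with respect to the norm $\|\Phi\|_2=\big(\sup_x\int|\Phi(\xi^{-1})|^2\,d\nu^x(\xi)\big)^{1/2}$ on $C_c(\mathcal G)$. Let $c:\mathcal G\to\mathbb R$ be a regular cocycle, i.e. a continuous groupoid homomorphism whose kernel $\mathcal H=\{\xi: c(\xi)=0\}$ admits a Haar system; fix a Haar system $\lambda$ on $\mathcal H$ and form $C^*(\mathcal H)$, $C^*_r(\mathcal H)$ with it. For $\Phi,\Psi\in C_c(\mathcal G)$ and $h\in C_c(\mathcal H)$ put $$\langle\Phi,\Psi\rangle_{\mathcal H}(\chi)=\int_{\mathcal G}\overline{\Phi(\xi^{-1})}\,\Psi(\xi^{-1}\chi)\,d\nu^{r(\chi)}(\xi)\quad(\chi\in\mathcal H),\qquad (\Phi\cdot h)(z)=\int_{\mathcal H}\Phi(z\chi)h(\chi^{-1})\,d\lambda^{d(z)}(\chi)\quad(z\in\mathcal G).$$ Let $\mathcal E^{\mathcal G}$ (respectively $\mathcal E^{\mathcal G}_r$) be the completion of $C_c(\mathcal G)$ in the norm $\|\langle\Phi,\Phi\rangle_{\mathcal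 H}\|^{1/2}$, taken in $C^*(\mathcal H)$ (respectively $C^*_r(\mathcal H)$). It is a right Hilbert $C^*$-module over $C^*(\mathcal H)$ (respectively $C^*_r(\mathcal H)$) for the continuous extensions of these two operations, and $C^*(\mathcal G)$ (respectively $C^*_r(\mathcal G)$) acts on it from the left by adjointable operators, by the continuous extension of convolution. Adjointable operators are the maps $T$ for which there is a map $T^*$ with $\langle Te_1,e_2\rangle=\langle e_1,T^*e_2\rangle$ for all $e_1,e_2$. **Proposition.** For $t\in\mathbb R$, the map $f\mapsto e^{itc}f$ of $C_c(\mathcal G)$ extends * to a bounded operator $u_t$ on $C^*(\mathcal G)$ (respectively $C^*_r(\mathcal G)$), and $(u_t)_{t\in\mathbb R}$ is a one-parameter group of $*$-automorphisms, with $t\mapsto u_t(a)$ norm continuous for every $a$ (Renault's automorphism group); * to a bounded operator $U_t$ on $\mathcal E^{\mathcal G}$ (respectively $\mathcal E^{\mathcal G}_r$), and $(U_t)_{t\in\mathbb R}$ is a one-parameter group of $C^*(\mathcal H)$-linear (respectively $C^*_r(\mathcal H)$-linear) unitary adjointable operators, with $U_t^*=U_{-t}$ and $t\mapsto U_te$ norm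 continuous for every $e$. The group $(U_t)$ implements $(u_t)$: for all $t\in\mathbb R$, all $a$ in $C^*(\mathcal G)$ (respectively $C^*_r(\mathcal G)$) and all $e$ in $\mathcal E^{\mathcal G}$ (respectively $\mathcal E^{\mathcal G}_r$), $$U_t\big(a\cdot U_t^*e\big)=u_t(a)\cdot e .$$ -/

import Mathlib

open MeasureTheory Filter Topology
open scoped CompactlySupported

set_option linter.unusedSectionVars false

universe u

noncomputable section

/-! ## Locally compact groupoids, Haar systems, cocycles -/

/-- A topological groupoid, presented by its space `G` of arrows. Objects are identified with the
identity arrows; `d` and `r` are the domain and range maps, and `mul ξ η` is the composite of a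
composable pair (`d ξ = r η`). -/
class TopologicalGroupoid (G : Type u) [TopologicalSpace G] where
  d : G → G
  r : G → G
  mul : (ξ η : G) → d ξ = r η → G
  inv : G → G
  d_d : ∀ ξ, d (d ξ) = d ξ
  r_d : ∀ ξ, r (d ξ) = d ξ
  d_r : ∀ ξ, d (r ξ) = r ξ
  r_r : ∀ ξ, r (r ξ) = r ξ
  d_mul : ∀ ξ η h, d (mul ξ η h) = d η
  r_mul : ∀ ξ η h, r (mul ξ η h) = r ξ
  assoc : ∀ ξ η ζ (h₁ : d ξ = r η) (h₂ : d η = r ζ),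
    mul (mul ξ η h₁) ζ ((d_mul ξ η h₁).trans h₂) = mul ξ (mul η ζ h₂) (h₁.trans (r_mul η ζ h₂).symm)
  mul_unit : ∀ ξ, mul ξ (d ξ) (r_d ξ).symm = ξ
  unit_mul : ∀ ξ, mul (r ξ) ξ (d_r ξ) = ξ
  d_inv : ∀ ξ, d (inv ξ) = r ξ
  r_inv : ∀ ξ, r (inv ξ) = d ξ
  comp_inv : ∀ ξ, mul ξ (inv ξ) (r_inv ξ).symm = r ξ
  inv_comp : ∀ ξ, mul (inv ξ) ξ (d_inv ξ) = d ξ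
  continuous_d : Continuous d
  continuous_r : Continuous r
  continuous_inversion : Continuous inv
  continuous_composition : Continuous fun p : {p : G × G // d p.1 = r p.2} => mul p.1.1 p.1.2 p.2

namespace TopologicalGroupoid

variable {G : Type u} [TopologicalSpace G] [TopologicalGroupoid G]

variable (G) in
/-- The unit space `G⁽⁰⁾`, as a subspace of `G`. -/
abbrev UnitSpace : Type u := {x : G // r x = x}

/-- The range map with values in the unit space. -/
def rangeUnit (ξ : G) : UnitSpace G := ⟨r ξ, r_r ξ⟩

/-- The domain map with values in the unit space. -/
def sourceUnit (ξ : G) : UnitSpace G := ⟨d ξ, r_d ξ⟩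

open Classical in
/-- `f (ξη)` if `ξ` and `η` are composable, and `0` otherwise. -/
def evalMul (f : G → ℂ) (ξ η : G) : ℂ := if h : d ξ = r η then f (mul ξ η h) else 0

end TopologicalGroupoid

open TopologicalGroupoid

/-- A Haar system: a family of Radon measures `ν x` indexed by the units, such that `ν x` has
support `r⁻¹(x)`, the family is left invariant, and integration maps `C_c(G)` to continuous
functions on the unit space. -/
structure HaarSystem (G : Type u) [TopologicalSpace G] [MeasurableSpace G] [BorelSpace G]
    [TopologicalGroupoid G] where
  ν : UnitSpace G → Measure G
  regular : ∀ x, (ν x).Regular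
  support_eq : ∀ x : UnitSpace G, (ν x).support = {ξ : G | r ξ = (x : G)}
  invariant : ∀ (η : G) (f : C_c(G, ℂ)),
    ∫ ξ, f ξ ∂ν (rangeUnit η) = ∫ ξ, evalMul f η ξ ∂ν (sourceUnit η)
  continuous_integral : ∀ f : C_c(G, ℂ), Continuous fun x => ∫ ξ, f ξ ∂ν x

/-- A (real, continuous) cocycle: a continuous homomorphism `G → ℝ`. -/
structure Cocycle (G : Type u) [TopologicalSpace G] [TopologicalGroupoid G] where
  toFun : G → ℝ
  continuous_toFun : Continuous toFun
  map_mul : ∀ ξ η h, toFun (mul ξ η h) = toFun ξ + toFun η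

namespace Cocycle

variable {G : Type u} [TopologicalSpace G] [TopologicalGroupoid G]

instance : CoeFun (Cocycle G) fun _ => G → ℝ := ⟨Cocycle.toFun⟩

theorem map_unit (c : Cocycle G) {x : G} (hx : r x = x) : c x = 0 := by
  have h := c.map_mul (r x) x (d_r x)
  rw [unit_mul, hx] at h
  linarith

theorem map_inv (c : Cocycle G) (ξ : G) : c (inv ξ) = - c ξ := by
  have h := c.map_mul ξ (inv ξ) (r_inv ξ).symm
  rw [comp_inv, c.map_unit (r_r ξ)] at h
  linarith

/-- The kernel `H = {ξ | c ξ = 0}` with the subspace topology. -/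
def Ker (c : Cocycle G) : Type u := {ξ : G // c ξ = 0}

variable (c : Cocycle G)

instance : TopologicalSpace c.Ker := inferInstanceAs (TopologicalSpace {ξ : G // c ξ = 0})

instance [T2Space G] : T2Space c.Ker := inferInstanceAs (T2Space {ξ : G // c ξ = 0})

theorem isClosed_ker : IsClosed {ξ : G | c ξ = 0} :=
  isClosed_eq c.continuous_toFun continuous_const

instance [LocallyCompactSpace G] : LocallyCompactSpace c.Ker :=
  c.isClosed_ker.isClosedEmbedding_subtypeVal.locallyCompactSpace

instance [MeasurableSpace G] : MeasurableSpace c.Ker :=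
  inferInstanceAs (MeasurableSpace {ξ : G // c ξ = 0})

instance [MeasurableSpace G] [BorelSpace G] : BorelSpace c.Ker :=
  inferInstanceAs (BorelSpace {ξ : G // c ξ = 0})

/-- The inclusion `H → G`. -/
def incl (χ : c.Ker) : G := χ.1

theorem isClosedEmbedding_incl : IsClosedEmbedding c.incl :=
  c.isClosed_ker.isClosedEmbedding_subtypeVal

theorem d_mem (χ : c.Ker) : c (d χ.1) = 0 := c.map_unit (r_d _)

theorem r_mem (χ : c.Ker) : c (r χ.1) = 0 := c.map_unit (r_r _)

theorem mul_mem (χ ψ : c.Ker) (h : d χ.1 = r ψ.1) : c (mul χ.1 ψ.1 h) = 0 := by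
  rw [c.map_mul, χ.2, ψ.2, add_zero]

theorem inv_mem (χ : c.Ker) : c (inv χ.1) = 0 := by rw [c.map_inv, χ.2, neg_zero]

theorem continuous_ker_mul : Continuous fun p : {p : c.Ker × c.Ker //
    (⟨d p.1.1, c.d_mem p.1⟩ : c.Ker) = ⟨r p.2.1, c.r_mem p.2⟩} =>
    (⟨mul p.1.1.1 p.1.2.1 (congrArg Subtype.val p.2), c.mul_mem _ _ _⟩ : c.Ker) := by
  refine Continuous.subtype_mk ?_ _
  have h : Continuous fun p : {p : c.Ker × c.Ker //
      (⟨d p.1.1, c.d_mem p.1⟩ : c.Ker) = ⟨r p.2.1, c.r_mem p.2⟩} =>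
      (⟨(c.incl p.1.1, c.incl p.1.2), congrArg Subtype.val p.2⟩ :
        {p : G × G // d p.1 = r p.2}) := by
    refine Continuous.subtype_mk ?_ _
    have := c.isClosedEmbedding_incl.continuous
    fun_prop
  exact continuous_composition.comp h

/-- The subgroupoid structure of the kernel. -/
instance : TopologicalGroupoid c.Ker where
  d χ := ⟨d χ.1, c.d_mem χ⟩
  r χ := ⟨r χ.1, c.r_mem χ⟩
  mul χ ψ h := ⟨mul χ.1 ψ.1 (congrArg Subtype.val h), c.mul_mem _ _ _⟩
  inv χ := ⟨inv χ.1, c.inv_mem χ⟩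
  d_d _ := Subtype.ext (d_d _)
  r_d _ := Subtype.ext (r_d _)
  d_r _ := Subtype.ext (d_r _)
  r_r _ := Subtype.ext (r_r _)
  d_mul _ _ _ := Subtype.ext (d_mul _ _ _)
  r_mul _ _ _ := Subtype.ext (r_mul _ _ _)
  assoc _ _ _ _ _ := Subtype.ext (assoc _ _ _ _ _)
  mul_unit _ := Subtype.ext (mul_unit _)
  unit_mul _ := Subtype.ext (unit_mul _)
  d_inv _ := Subtype.ext (d_inv _)
  r_inv _ := Subtype.ext (r_inv _)
  comp_inv _ := Subtype.ext (comp_inv _)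
  inv_comp _ := Subtype.ext (inv_comp _)
  continuous_d := (continuous_d.comp continuous_subtype_val).subtype_mk _
  continuous_r := (continuous_r.comp continuous_subtype_val).subtype_mk _
  continuous_inversion := (continuous_inversion.comp continuous_subtype_val).subtype_mk _
  continuous_composition := c.continuous_ker_mul

/-- The unit of `H = ker c` at the domain of an arrow of `G` (recall `H⁽⁰⁾ = G⁽⁰⁾`). -/
def kerSourceUnit (z : G) : UnitSpace c.Ker :=
  ⟨⟨d z, c.map_unit (r_d z)⟩, Subtype.ext (r_d z)⟩

/-- The phase multiplication `f ↦ e^{itc} f` on `C_c(G)`. -/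
def phase (t : ℝ) (f : C_c(G, ℂ)) : C_c(G, ℂ) where
  toFun ξ := Complex.exp (Complex.I * t * c ξ) * f ξ
  continuous_toFun := by
    have := c.continuous_toFun
    fun_prop
  hasCompactSupport' := f.hasCompactSupport.mul_left

/-- Restriction of a compactly supported function to the closed subgroupoid `ker c`. -/
def restrict (f : C_c(G, ℂ)) : C_c(c.Ker, ℂ) where
  toFun χ := f (c.incl χ)
  continuous_toFun := f.continuous.comp c.isClosedEmbedding_incl.continuous
  hasCompactSupport' := f.hasCompactSupport.comp_isClosedEmbedding c.isClosedEmbedding_incl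

end Cocycle

/-! ## Fibrewise integration produces continuous functions -/

section Fibre

variable {G : Type u} [TopologicalSpace G] [T2Space G] [LocallyCompactSpace G]

theorem exists_cutoff {K : Set G} (hK : IsCompact K) :
    ∃ θ : C_c(G, ℂ), (∀ ξ ∈ K, θ ξ = 1) ∧ ∀ ξ, ∃ s : ℝ, 0 ≤ s ∧ θ ξ = s := by
  obtain ⟨f, h1, -, h3, h4⟩ :=
    exists_continuous_one_zero_of_isCompact hK isClosed_empty (Set.disjoint_empty K)
  refine ⟨⟨⟨fun ξ => (f ξ : ℂ), by fun_prop⟩, ?_⟩, fun ξ hξ => ?_, fun ξ => ⟨f ξ, (h4 ξ).1, rfl⟩⟩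
  · exact h3.comp_left (g := fun x : ℝ => (x : ℂ)) Complex.ofReal_zero
  · have : f ξ = 1 := h1 hξ
    simp [this]

/-- A continuous function on a closed set that vanishes off a compact set extends to `C_c(G)`. -/
theorem exists_extension_of_closed {S K : Set G} (hS : IsClosed S) (hK : IsCompact K) {φ : G → ℂ}
    (hφ : ContinuousOn φ S) (h0 : ∀ ξ ∈ S, ξ ∉ K → φ ξ = 0) :
    ∃ g : C_c(G, ℂ), ∀ ξ ∈ S, g ξ = φ ξ := by
  obtain ⟨θ, hθ, -⟩ := exists_cutoff hK
  have hC : IsCompact (S ∩ tsupport θ) := θ.hasCompactSupport.isCompact.inter_left hS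
  let e : (S ∩ tsupport θ : Set G) → OnePoint G := fun x => (x.1 : OnePoint G)
  have he : IsClosedEmbedding e := by
    have : CompactSpace (S ∩ tsupport θ : Set G) := isCompact_iff_compactSpace.mp hC
    refine Continuous.isClosedEmbedding (OnePoint.continuous_coe.comp continuous_subtype_val) ?_
    exact OnePoint.coe_injective.comp Subtype.val_injective
  obtain ⟨g, hg⟩ := ContinuousMap.exists_extension he
    (⟨fun x => φ x.1, (hφ.mono Set.inter_subset_left).domRestrict⟩ : C((S ∩ tsupport θ : Set G), ℂ))
  refine ⟨⟨⟨fun ξ => θ ξ * g (ξ : OnePoint G), ?_⟩, θ.hasCompactSupport.mul_right⟩, fun ξ hξ => ?_⟩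
  · exact θ.continuous.mul (g.continuous.comp OnePoint.continuous_coe)
  · change θ ξ * g (ξ : OnePoint G) = φ ξ
    by_cases hs : ξ ∈ tsupport θ
    · have h1 : g (ξ : OnePoint G) = φ ξ := by
        have := congrArg (fun k => k ⟨ξ, hξ, hs⟩) hg
        exact this
      by_cases hk : ξ ∈ K
      · rw [hθ ξ hk, h1, one_mul]
      · rw [h1, h0 ξ hξ hk, mul_zero]
    · have hk : ξ ∉ K := fun hk => hs (subset_tsupport _ (by simp [hθ ξ hk]))
      rw [image_eq_zero_of_notMem_tsupport hs, zero_mul, h0 ξ hξ hk]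

variable [MeasurableSpace G] [BorelSpace G] [TopologicalGroupoid G] (ν : HaarSystem G)

theorem HaarSystem.ae_mem_fibre (x : UnitSpace G) : ∀ᵐ ξ : G ∂ν.ν x, r ξ = (x : G) := by
  have := ν.regular x
  have h := Measure.support_mem_ae_of_regular (μ := ν.ν x)
  rwa [ν.support_eq] at h

theorem HaarSystem.integrable (x : UnitSpace G) (f : C_c(G, ℂ)) : Integrable f (ν.ν x) := by
  have := ν.regular x
  exact f.continuous.integrable_of_hasCompactSupport f.hasCompactSupport

/-- Fibrewise integration of a continuous function on a fibred product, with locally uniformly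
compact supports, gives a continuous function. -/
theorem HaarSystem.continuous_integral_param {Z : Type*} [TopologicalSpace Z] {p : Z → UnitSpace G}
    (hp : Continuous p) {F : Z → G → ℂ}
    (hF : ContinuousOn (fun q : Z × G => F q.1 q.2) {q : Z × G | r q.2 = (p q.1 : G)})
    {K : Set G} (hK : IsCompact K) (hFK : ∀ (z : Z) (ξ : G), r ξ = (p z : G) → ξ ∉ K → F z ξ = 0) :
    Continuous fun z => ∫ ξ, F z ξ ∂ν.ν (p z) := by
  have hfib : ∀ z, IsClosed {ξ : G | r ξ = (p z : G)} := fun z =>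
    isClosed_eq continuous_r continuous_const
  have hext : ∀ z, ∃ g : C_c(G, ℂ), ∀ ξ ∈ {ξ : G | r ξ = (p z : G)}, g ξ = F z ξ := fun z => by
    refine exists_extension_of_closed (hfib z) hK ?_ (fun ξ h1 h2 => hFK z ξ h1 h2)
    exact hF.comp (f := fun ξ => (z, ξ)) (by fun_prop) (fun ξ h => h)
  have hint : ∀ z, Integrable (F z) (ν.ν (p z)) := fun z => by
    obtain ⟨g, hg⟩ := hext z
    refine (ν.integrable (p z) g).congr ?_
    filter_upwards [ν.ae_mem_fibre (p z)] with ξ h using hg ξ h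
  rw [continuous_iff_continuousAt]
  intro z₀
  obtain ⟨g, hg⟩ := hext z₀
  obtain ⟨θ, hθ1, hθ⟩ := exists_cutoff (hK.union g.hasCompactSupport.isCompact)
  set K' := K ∪ tsupport g
  have hK' : IsCompact K' := hK.union g.hasCompactSupport.isCompact
  have hcg : ContinuousAt (fun z => ∫ ξ, g ξ ∂ν.ν (p z)) z₀ :=
    ((ν.continuous_integral g).comp hp).continuousAt
  have hcθ : ContinuousAt (fun z => ∫ ξ, θ ξ ∂ν.ν (p z)) z₀ :=
    ((ν.continuous_integral θ).comp hp).continuousAt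
  have hθnorm : ∀ z, ∫ ξ, ‖θ ξ‖ ∂ν.ν (p z) = ‖∫ ξ, θ ξ ∂ν.ν (p z)‖ := fun z => by
    have h1 : ∀ ξ, θ ξ = ((‖θ ξ‖ : ℝ) : ℂ) := fun ξ => by
      obtain ⟨s, hs, h⟩ := hθ ξ
      rw [h, Complex.norm_real, Real.norm_of_nonneg hs]
    have h2 : ∫ ξ, θ ξ ∂ν.ν (p z) = ((∫ ξ, ‖θ ξ‖ ∂ν.ν (p z) : ℝ) : ℂ) := by
      rw [← integral_complex_ofReal]
      exact integral_congr_ae (Eventually.of_forall h1)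
    rw [h2, Complex.norm_real, Real.norm_of_nonneg (integral_nonneg fun _ => norm_nonneg _)]
  have hdiff : Tendsto (fun z => ∫ ξ, F z ξ - g ξ ∂ν.ν (p z)) (𝓝 z₀) (𝓝 0) := by
    set M := ‖∫ ξ, θ ξ ∂ν.ν (p z₀)‖ + 1 with hM
    have hMpos : 0 < M := by positivity
    rw [Metric.tendsto_nhds]
    intro ε hε
    have hδ : 0 < ε / (2 * M) := by positivity
    have h1 : ∀ᶠ z in 𝓝 z₀, ∀ ξ ∈ K', r ξ = (p z : G) → ‖F z ξ - g ξ‖ < ε / (2 * M) := by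
      refine hK'.eventually_forall_of_forall_eventually fun ξ _ => ?_
      by_cases hr : r ξ = (p z₀ : G)
      · have hc : ContinuousWithinAt (fun q : Z × G => F q.1 q.2 - g q.2)
            {q : Z × G | r q.2 = (p q.1 : G)} (z₀, ξ) :=
          (hF (z₀, ξ) hr).sub (g.continuous.comp continuous_snd).continuousWithinAt
        have h0 : F z₀ ξ - g ξ = 0 := by
          rw [hg ξ hr, sub_self]
        have := Metric.tendsto_nhds.mp hc.tendsto _ hδ
        simp only [h0] at this
        rw [eventually_nhdsWithin_iff] at this
        filter_upwards [this] with q hq hq'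
        simpa using hq hq'
      · have ho : IsOpen {q : Z × G | r q.2 ≠ (p q.1 : G)} :=
          isOpen_ne_fun (continuous_r.comp continuous_snd)
            (continuous_subtype_val.comp (hp.comp continuous_fst))
        filter_upwards [ho.mem_nhds (show (z₀, ξ) ∈ {q : Z × G | r q.2 ≠ (p q.1 : G)} from hr)]
          with q hq hq' using absurd hq' hq
    have h2 : ∀ᶠ z in 𝓝 z₀, ‖∫ ξ, θ ξ ∂ν.ν (p z)‖ < M :=
      hcθ.norm.eventually (gt_mem_nhds (by simp [hM]))
    filter_upwards [h1, h2] with z hz1 hz2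
    rw [dist_zero_right]
    calc ‖∫ ξ, F z ξ - g ξ ∂ν.ν (p z)‖
        ≤ ∫ ξ, (ε / (2 * M)) * ‖θ ξ‖ ∂ν.ν (p z) := by
          refine norm_integral_le_of_norm_le ((ν.integrable (p z) θ).norm.const_mul _) ?_
          filter_upwards [ν.ae_mem_fibre (p z)] with ξ hξ
          by_cases hk : ξ ∈ K'
          · rw [hθ1 ξ hk, norm_one, mul_one]
            exact (hz1 ξ hk hξ).le
          · have hk1 : ξ ∉ K := fun h => hk (Or.inl h)
            have hk2 : ξ ∉ tsupport g := fun h => hk (Or.inr h)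
            rw [hFK z ξ hξ hk1, image_eq_zero_of_notMem_tsupport hk2, sub_zero, norm_zero]
            positivity
      _ = (ε / (2 * M)) * ‖∫ ξ, θ ξ ∂ν.ν (p z)‖ := by
          rw [integral_const_mul, hθnorm]
      _ ≤ (ε / (2 * M)) * M := by gcongr
      _ = ε / 2 := by field_simp
      _ < ε := by linarith
  have := hcg.tendsto.add hdiff
  have heq : ∫ ξ, g ξ ∂ν.ν (p z₀) = ∫ ξ, F z₀ ξ ∂ν.ν (p z₀) :=
    integral_congr_ae ((ν.ae_mem_fibre (p z₀)).mono fun ξ h => hg ξ h)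
  rw [add_zero, heq] at this
  refine Tendsto.congr (fun z => ?_) this
  rw [integral_sub (hint z) (ν.integrable _ g)]
  ring

end Fibre

/-! ## The convolution algebra and the bimodule structure on `C_c(G)` -/

namespace TopologicalGroupoid

variable {G : Type u} [TopologicalSpace G] [TopologicalGroupoid G]

theorem inv_inv' (ξ : G) : inv (inv ξ) = ξ := by
  have h := assoc (inv (inv ξ)) (inv ξ) ξ (d_inv _) (d_inv _)
  have h1 := unit_mul ξ
  have h2 := mul_unit (inv (inv ξ))
  simp only [inv_comp, d_inv, r_inv] at h h2
  rw [h1] at h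
  rw [h2] at h
  exact h.symm

theorem mul_inv_mul (ξ η : G) (h : d (inv ξ) = r η) :
    mul ξ (mul (inv ξ) η h) ((r_mul _ _ _).trans (r_inv ξ)).symm = η := by
  have h0 := assoc ξ (inv ξ) η (r_inv ξ).symm h
  have h1 := unit_mul η
  have h2 : r ξ = r η := (d_inv ξ).symm.trans h
  simp only [comp_inv, h2] at h0
  rw [← h0, h1]

theorem mul_mul_inv (z χ : G) (h : d z = r χ) :
    mul (mul z χ h) (inv χ) ((d_mul _ _ _).trans (r_inv χ).symm) = z := by
  have h0 := assoc z χ (inv χ) h (r_inv χ).symm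
  have h1 := mul_unit z
  simp only [comp_inv, ← h] at h0
  rw [h0, h1]

/-- The inversion map as a homeomorphism. -/
def invHomeo (G : Type u) [TopologicalSpace G] [TopologicalGroupoid G] : G ≃ₜ G where
  toFun := inv
  invFun := inv
  left_inv := inv_inv'
  right_inv := inv_inv'
  continuous_toFun := continuous_inversion
  continuous_invFun := continuous_inversion

theorem continuousOn_evalMul {Z : Type*} [TopologicalSpace Z] {f : G → ℂ} (hf : Continuous f)
    {a b : Z → G} (ha : Continuous a) (hb : Continuous b) {S : Set Z}
    (hS : ∀ z ∈ S, d (a z) = r (b z)) : ContinuousOn (fun z => evalMul f (a z) (b z)) S := by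
  rw [continuousOn_iff_continuous_domRestrict]
  have h : Continuous fun z : S => (⟨(a z, b z), hS z z.2⟩ : {p : G × G // d p.1 = r p.2}) :=
    Continuous.subtype_mk (by fun_prop) _
  refine (hf.comp (continuous_composition.comp h)).congr fun z => ?_
  simp [evalMul, hS z z.2]

/-- The set of all products of composable pairs in `A × B`. -/
def prodSet (A B : Set G) : Set G :=
  (fun p : {p : G × G // d p.1 = r p.2} => mul p.1.1 p.1.2 p.2) '' (Subtype.val ⁻¹' (A ×ˢ B))

theorem isCompact_prodSet [T2Space G] {A B : Set G} (hA : IsCompact A) (hB : IsCompact B) :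
    IsCompact (prodSet A B) := by
  have hcl : IsClosed {p : G × G | d p.1 = r p.2} :=
    isClosed_eq (continuous_d.comp continuous_fst) (continuous_r.comp continuous_snd)
  exact (hcl.isClosedEmbedding_subtypeVal.isCompact_preimage (hA.prod hB)).image
    continuous_composition

theorem mem_prodSet {A B : Set G} {ξ η : G} (h : d ξ = r η) (hA : ξ ∈ A) (hB : η ∈ B) :
    mul ξ η h ∈ prodSet A B := ⟨⟨(ξ, η), h⟩, ⟨hA, hB⟩, rfl⟩

/-- The involution `f*(ξ) = conj (f (ξ⁻¹))` on `C_c(G)`. -/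
def invol (f : C_c(G, ℂ)) : C_c(G, ℂ) where
  toFun ξ := starRingEnd ℂ (f (inv ξ))
  continuous_toFun := Complex.continuous_conj.comp (f.continuous.comp continuous_inversion)
  hasCompactSupport' :=
    (f.hasCompactSupport.comp_homeomorph (invHomeo G)).comp_left (map_zero (starRingEnd ℂ))

end TopologicalGroupoid

section Convolution

variable {G : Type u} [TopologicalSpace G] [T2Space G] [LocallyCompactSpace G]
  [MeasurableSpace G] [BorelSpace G] [TopologicalGroupoid G] (ν : HaarSystem G)

/-- The convolution product `(f * g)(η) = ∫ f(ξ) g(ξ⁻¹η) dν^{r(η)}(ξ)` on `C_c(G)`. -/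
def HaarSystem.conv (f g : C_c(G, ℂ)) : C_c(G, ℂ) where
  toFun η := ∫ ξ, f ξ * evalMul g (inv ξ) η ∂ν.ν (rangeUnit η)
  continuous_toFun := by
    refine ν.continuous_integral_param (Z := G) (p := rangeUnit)
      (continuous_r.subtype_mk _) (F := fun η ξ => f ξ * evalMul g (inv ξ) η) ?_
      f.hasCompactSupport.isCompact ?_
    · refine (f.continuous.comp continuous_snd).continuousOn.mul ?_
      refine continuousOn_evalMul g.continuous (continuous_inversion.comp continuous_snd)
        continuous_fst fun q hq => ?_
      exact (d_inv _).trans hq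
    · intro η ξ _ hξ
      rw [image_eq_zero_of_notMem_tsupport hξ, zero_mul]
  hasCompactSupport' := by
    refine HasCompactSupport.intro
      (isCompact_prodSet f.hasCompactSupport.isCompact g.hasCompactSupport.isCompact) fun η hη => ?_
    refine integral_eq_zero_of_ae (Eventually.of_forall fun ξ => ?_)
    by_contra hne
    have h1 : f ξ ≠ 0 := left_ne_zero_of_mul hne
    have h2 : evalMul g (inv ξ) η ≠ 0 := right_ne_zero_of_mul hne
    unfold evalMul at h2
    split_ifs at h2 with h
    · refine hη ?_
      rw [← mul_inv_mul ξ η h]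
      exact mem_prodSet _ (subset_tsupport _ h1) (subset_tsupport _ h2)
    · exact h2 rfl

variable {c : Cocycle G} (lam : HaarSystem c.Ker)

/-- The right action `(Φ·h)(z) = ∫ Φ(zχ) h(χ⁻¹) dλ^{d(z)}(χ)` of `C_c(ker c)` on `C_c(G)`. -/
def HaarSystem.rightAct (Φ : C_c(G, ℂ)) (h : C_c(c.Ker, ℂ)) : C_c(G, ℂ) where
  toFun z := ∫ χ, evalMul Φ z (c.incl χ) * h (inv χ) ∂lam.ν (c.kerSourceUnit z)
  continuous_toFun := by
    refine lam.continuous_integral_param (Z := G) (p := c.kerSourceUnit)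
      ((continuous_d.subtype_mk _).subtype_mk _)
      (F := fun z χ => evalMul Φ z (c.incl χ) * h (inv χ)) ?_
      (K := (invHomeo c.Ker) ⁻¹' tsupport h)
      ((invHomeo c.Ker).isCompact_preimage.mpr h.hasCompactSupport.isCompact) ?_
    · refine ContinuousOn.mul ?_
        (h.continuous.comp (continuous_inversion.comp continuous_snd)).continuousOn
      refine continuousOn_evalMul Φ.continuous continuous_fst
        (c.isClosedEmbedding_incl.continuous.comp continuous_snd) fun q hq => ?_
      exact (congrArg Subtype.val hq).symm
    · intro z χ _ hχ
      have : h (inv χ) = 0 := image_eq_zero_of_notMem_tsupport hχ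
      rw [this, mul_zero]
  hasCompactSupport' := by
    refine HasCompactSupport.intro (isCompact_prodSet Φ.hasCompactSupport.isCompact
      (h.hasCompactSupport.isCompact.image c.isClosedEmbedding_incl.continuous)) fun z hz => ?_
    refine integral_eq_zero_of_ae (Eventually.of_forall fun χ => ?_)
    by_contra hne
    have h1 : evalMul Φ z (c.incl χ) ≠ 0 := left_ne_zero_of_mul hne
    have h2 : h (inv χ) ≠ 0 := right_ne_zero_of_mul hne
    unfold evalMul at h1
    split_ifs at h1 with hc
    · refine hz ?_
      rw [← mul_mul_inv z (c.incl χ) hc]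
      exact mem_prodSet _ (subset_tsupport _ h1) ⟨inv χ, subset_tsupport _ h2, rfl⟩
    · exact h1 rfl

variable (c) in
/-- The `C_c(ker c)`-valued inner product
`⟨Φ, Ψ⟩(χ) = ∫ conj (Φ(ξ⁻¹)) Ψ(ξ⁻¹χ) dν^{r(χ)}(ξ)`, i.e. the restriction of `Φ* * Ψ`. -/
def HaarSystem.innerKer (Φ Ψ : C_c(G, ℂ)) : C_c(c.Ker, ℂ) := c.restrict (ν.conv (invol Φ) Ψ)

end Convolution

/-! ## Completions -/

section Completions

variable {V : Type u} [AddCommGroup V] [Module ℂ V]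

/-- The greatest seminorm dominated by `N`. It is `N` itself whenever `N` is a seminorm (see
`greatestSeminorm_eq`). It is only applied to the reduced norm and to the norm of a Hilbert
`C*`-module, which are seminorms, so that these constructions do not have to carry a proof of it. -/
def greatestSeminorm (N : V → ℝ) : Seminorm ℂ V := sSup {p | ∀ v, p v ≤ N v}

theorem greatestSeminorm_eq (p : Seminorm ℂ V) {N : V → ℝ} (h : ∀ v, N v = p v) :
    greatestSeminorm N = p := by
  have : {q : Seminorm ℂ V | ∀ v, q v ≤ N v} = Set.Iic p := by
    ext q
    exact forall_congr' fun v => by rw [h v]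
  rw [greatestSeminorm, this]
  exact csSup_Iic

/-- The vector space `V` equipped with the seminorm `p`. -/
def WithSeminorm (_p : Seminorm ℂ V) : Type u := V

variable (p : Seminorm ℂ V)

instance : SeminormedAddCommGroup (WithSeminorm p) :=
  p.toAddGroupSeminorm.toSeminormedAddCommGroup

instance : Module ℂ (WithSeminorm p) := inferInstanceAs (Module ℂ V)

instance : NormedSpace ℂ (WithSeminorm p) where
  norm_smul_le z v := (map_smul_eq_mul p z v).le

/-- The (Hausdorff) completion of `V` in the seminorm `p`, a Banach space. -/
def SeminormCompletion : Type u := UniformSpace.Completion (WithSeminorm p)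

instance : NormedAddCommGroup (SeminormCompletion p) :=
  inferInstanceAs (NormedAddCommGroup (UniformSpace.Completion (WithSeminorm p)))

instance : NormedSpace ℂ (SeminormCompletion p) :=
  inferInstanceAs (NormedSpace ℂ (UniformSpace.Completion (WithSeminorm p)))

instance : CompleteSpace (SeminormCompletion p) :=
  inferInstanceAs (CompleteSpace (UniformSpace.Completion (WithSeminorm p)))

/-- The canonical map of `V` into its completion. -/
def toCompletion (v : V) : SeminormCompletion p :=
  ((show WithSeminorm p from v : WithSeminorm p) : UniformSpace.Completion (WithSeminorm p))

open Classical in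
/-- The extension by continuity of `f : α → γ` along `i : α → β`: its value at `b` is the limit of
`f a` as `i a → b` (and `0` should this limit not exist). Below it is applied only to the operations
of the groupoid `C*`-algebras and of their correspondences, for which the limit exists. -/
def limitExtension {α β γ : Type*} [TopologicalSpace β] [TopologicalSpace γ] [Zero γ]
    (i : α → β) (f : α → γ) (b : β) : γ :=
  if h : ∃ y, Tendsto f (comap i (𝓝 b)) (𝓝 y) then h.choose else 0

/-- The extension by continuity to the completions of a map of two variables. -/
def limitExtension₂ {W X : Type u} [AddCommGroup W] [Module ℂ W] [AddCommGroup X] [Module ℂ X]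
    (p : Seminorm ℂ V) (q : Seminorm ℂ W) (s : Seminorm ℂ X) (B : V → W → X)
    (a : SeminormCompletion p) (b : SeminormCompletion q) : SeminormCompletion s :=
  limitExtension (Prod.map (toCompletion p) (toCompletion q))
    (fun x : V × W => toCompletion s (B x.1 x.2)) (a, b)

end Completions

/-! ## The full and the reduced `C*`-algebra of a groupoid -/

section GroupoidAlgebra

variable {G : Type u} [TopologicalSpace G] [T2Space G] [LocallyCompactSpace G]
  [MeasurableSpace G] [BorelSpace G] [TopologicalGroupoid G] (ν : HaarSystem G)

/-- The norm `‖f‖_I`. -/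
def HaarSystem.normI (f : C_c(G, ℂ)) : ℝ :=
  max (⨆ x, ∫ ξ, ‖f ξ‖ ∂ν.ν x) (⨆ x, ∫ ξ, ‖f (inv ξ)‖ ∂ν.ν x)

/-- Admissible representations of `C_c(G)` on a Hilbert space `K`: `*`-representations that are
bounded by the `I`-norm and continuous for the inductive limit topology on `C_c(G)` and the weak
operator topology, i.e. every matrix coefficient is, for each compact set `C`, continuous in the
supremum norm on the functions supported in `C`. -/
structure HaarSystem.IsAdmissible {K : Type u} [NormedAddCommGroup K] [InnerProductSpace ℂ K]
    [CompleteSpace K] (π : C_c(G, ℂ) →ₗ[ℂ] (K →L[ℂ] K)) : Prop where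
  map_conv : ∀ f g, π (ν.conv f g) = π f * π g
  map_invol : ∀ f, π (invol f) = ContinuousLinearMap.adjoint (π f)
  weakly_continuous : ∀ C : Set G, IsCompact C → ∀ k l : K, ∃ M : ℝ, ∀ f : C_c(G, ℂ),
    tsupport f ⊆ C → ∀ s : ℝ, (∀ ξ, ‖f ξ‖ ≤ s) → ‖inner ℂ k (π f l)‖ ≤ M * s
  norm_le : ∀ f, ‖π f‖ ≤ ν.normI f

/-- The full `C*`-norm `‖f‖ = sup {‖π(f)‖ : π admissible}`. Hilbert spaces in the universe of `G`
suffice: they include, up to isometry, all cyclic subrepresentations. -/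
def HaarSystem.fullNorm (f : C_c(G, ℂ)) : ℝ :=
  sSup {x : ℝ | ∃ (K : Type u) (_ : NormedAddCommGroup K) (_ : InnerProductSpace ℂ K)
    (_ : CompleteSpace K) (π : C_c(G, ℂ) →ₗ[ℂ] (K →L[ℂ] K)), ν.IsAdmissible π ∧ x = ‖π f‖}

theorem HaarSystem.norm_le_fullNorm {K : Type u} [NormedAddCommGroup K] [InnerProductSpace ℂ K]
    [CompleteSpace K] {π : C_c(G, ℂ) →ₗ[ℂ] (K →L[ℂ] K)} (hπ : ν.IsAdmissible π) (f : C_c(G, ℂ)) :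
    ‖π f‖ ≤ ν.fullNorm f := by
  refine le_csSup ⟨ν.normI f, ?_⟩ ⟨K, _, _, _, π, hπ, rfl⟩
  rintro x ⟨K, i1, i2, i3, π, hπ, rfl⟩
  exact hπ.norm_le f

theorem HaarSystem.fullNorm_nonneg (f : C_c(G, ℂ)) : 0 ≤ ν.fullNorm f := by
  refine Real.sSup_nonneg ?_
  rintro x ⟨K, i1, i2, i3, π, hπ, rfl⟩
  exact norm_nonneg _

/-- The full `C*`-norm as a seminorm. -/
def HaarSystem.full : Seminorm ℂ C_c(G, ℂ) :=
  Seminorm.ofSMulLE ν.fullNorm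
    (le_antisymm (Real.sSup_le (by
      rintro x ⟨K, i1, i2, i3, π, hπ, rfl⟩
      rw [map_zero, norm_zero]) le_rfl) (ν.fullNorm_nonneg 0))
    (fun f g => by
      refine Real.sSup_le ?_ (add_nonneg (ν.fullNorm_nonneg f) (ν.fullNorm_nonneg g))
      rintro x ⟨K, i1, i2, i3, π, hπ, rfl⟩
      rw [map_add]
      exact (norm_add_le _ _).trans
        (add_le_add (ν.norm_le_fullNorm hπ f) (ν.norm_le_fullNorm hπ g)))
    (fun w g => by
      refine Real.sSup_le ?_ (mul_nonneg (norm_nonneg _) (ν.fullNorm_nonneg g))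
      rintro x ⟨K, i1, i2, i3, π, hπ, rfl⟩
      rw [map_smul, norm_smul]
      exact mul_le_mul_of_nonneg_left (ν.norm_le_fullNorm hπ g) (norm_nonneg _))

/-- The norm of the `C₀(G⁽⁰⁾)`-module `L²(G, ν)` on `C_c(G)`:
`‖Φ‖² = sup_x ∫ |Φ(ξ⁻¹)|² dν^x(ξ)`. -/
def HaarSystem.normL2 (Φ : C_c(G, ℂ)) : ℝ :=
  √(⨆ x, ∫ ξ, ‖Φ (inv ξ)‖ ^ 2 ∂ν.ν x)

/-- The reduced norm: the operator norm of `Φ ↦ f * Φ` on `L²(G, ν)`. -/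
def HaarSystem.reducedNorm (f : C_c(G, ℂ)) : ℝ :=
  sSup {x : ℝ | ∃ Φ : C_c(G, ℂ), ν.normL2 Φ ≤ 1 ∧ x = ν.normL2 (ν.conv f Φ)}

/-- The reduced `C*`-norm as a seminorm. -/
def HaarSystem.reduced : Seminorm ℂ C_c(G, ℂ) := greatestSeminorm ν.reducedNorm

/-- The completion of the convolution `*`-algebra `C_c(G)` in the seminorm `p`. It is `C*(G)` for
`p = ν.full` and `C*_r(G)` for `p = ν.reduced`. -/
def HaarSystem.Alg (_ν : HaarSystem G) (p : Seminorm ℂ C_c(G, ℂ)) : Type u := SeminormCompletion p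

variable (p : Seminorm ℂ C_c(G, ℂ))

instance : NormedAddCommGroup (ν.Alg p) := inferInstanceAs (NormedAddCommGroup (SeminormCompletion p))

instance : NormedSpace ℂ (ν.Alg p) := inferInstanceAs (NormedSpace ℂ (SeminormCompletion p))

instance : CompleteSpace (ν.Alg p) := inferInstanceAs (CompleteSpace (SeminormCompletion p))

/-- The canonical map `C_c(G) → C*(G)` (or `C*_r(G)`). -/
def HaarSystem.toAlg (f : C_c(G, ℂ)) : ν.Alg p := toCompletion p f

/-- The product extends convolution. -/
instance : Mul (ν.Alg p) := ⟨limitExtension₂ p p p ν.conv⟩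

/-- The star operation extends the involution of `C_c(G)`. -/
instance : Star (ν.Alg p) := ⟨limitExtension (toCompletion p) fun f => toCompletion p (invol f)⟩

/-- One-parameter groups of `*`-automorphisms, continuous for the strict topology (pointwise norm
convergence). -/
structure HaarSystem.IsAutomorphismGroup (u : ℝ → ν.Alg p →L[ℂ] ν.Alg p) : Prop where
  zero : ∀ a, u 0 a = a
  add : ∀ s t a, u (s + t) a = u s (u t a)
  mul : ∀ t a b, u t (a * b) = u t a * u t b
  star : ∀ t a, u t (star a) = star (u t a)
  continuous : ∀ a, Continuous fun t => u t a

end GroupoidAlgebra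

/-! ## The correspondence `E^G` -/

section Correspondence

variable {G : Type u} [TopologicalSpace G] [T2Space G] [LocallyCompactSpace G]
  [MeasurableSpace G] [BorelSpace G] [TopologicalGroupoid G] (ν : HaarSystem G)
  {c : Cocycle G} (lam : HaarSystem c.Ker)
  (pG : Seminorm ℂ C_c(G, ℂ)) (pH : Seminorm ℂ C_c(c.Ker, ℂ))

/-- The norm `‖Φ‖ = ‖⟨Φ, Φ⟩‖^{1/2}` on `C_c(G)`, where `C_c(ker c)` carries the `C*`-norm `pH`. -/
def moduleSeminorm : Seminorm ℂ C_c(G, ℂ) :=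
  greatestSeminorm fun Φ => √(pH (ν.innerKer c Φ Φ))

/-- The completion of `C_c(G)` in the norm `‖⟨Φ, Φ⟩‖^{1/2}`. With `lam` the Haar system of
`H = ker c`, this is the module `E^G` over `C*(H)` for `pH = lam.full`, and the module `E^G_r` over
`C*_r(H)` for `pH = lam.reduced`. -/
def CorrModule (_lam : HaarSystem c.Ker) (pH : Seminorm ℂ C_c(c.Ker, ℂ)) : Type u :=
  SeminormCompletion (moduleSeminorm ν pH)

instance : NormedAddCommGroup (CorrModule ν lam pH) :=
  inferInstanceAs (NormedAddCommGroup (SeminormCompletion (moduleSeminorm ν pH)))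

instance : NormedSpace ℂ (CorrModule ν lam pH) :=
  inferInstanceAs (NormedSpace ℂ (SeminormCompletion (moduleSeminorm ν pH)))

instance : CompleteSpace (CorrModule ν lam pH) :=
  inferInstanceAs (CompleteSpace (SeminormCompletion (moduleSeminorm ν pH)))

namespace CorrModule

/-- The canonical map `C_c(G) → E^G`. -/
def of (Φ : C_c(G, ℂ)) : CorrModule ν lam pH := toCompletion (moduleSeminorm ν pH) Φ

variable {ν lam pG pH}

/-- The `C*(H)`-valued inner product of `E^G`. -/
def innerProd (e f : CorrModule ν lam pH) : lam.Alg pH :=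
  limitExtension₂ (moduleSeminorm ν pH) (moduleSeminorm ν pH) pH (ν.innerKer c) e f

/-- The right action of `C*(H)` on `E^G`. -/
def rightMul (e : CorrModule ν lam pH) (b : lam.Alg pH) : CorrModule ν lam pH :=
  limitExtension₂ (moduleSeminorm ν pH) pH (moduleSeminorm ν pH) lam.rightAct e b

/-- The left action of `C*(G)` on `E^G`, extending convolution. -/
def leftMul (a : ν.Alg pG) (e : CorrModule ν lam pH) : CorrModule ν lam pH :=
  limitExtension₂ pG (moduleSeminorm ν pH) (moduleSeminorm ν pH) ν.conv a e

/-- `T` is an adjointable operator with adjoint `S`. -/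
def IsAdjoint (T S : CorrModule ν lam pH → CorrModule ν lam pH) : Prop :=
  ∀ e f, innerProd (T e) f = innerProd e (S f)

/-- `T` is a unitary of the `*`-algebra of adjointable operators, with adjoint `S`. -/
structure IsUnitary (T S : CorrModule ν lam pH → CorrModule ν lam pH) : Prop where
  adjoint : IsAdjoint T S
  left_inv : ∀ e, S (T e) = e
  right_inv : ∀ e, T (S e) = e

/-- One-parameter groups of unitaries in the adjointable operators, continuous for the strict
topology (pointwise norm convergence). -/
structure IsUnitaryGroup (U : ℝ → CorrModule ν lam pH →L[ℂ] CorrModule ν lam pH) : Prop where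
  zero : ∀ e, U 0 e = e
  add : ∀ s t e, U (s + t) e = U s (U t e)
  unitary : ∀ t, IsUnitary (U t) (U (-t))
  rightLinear : ∀ t e b, U t (rightMul e b) = rightMul (U t e) b
  continuous : ∀ e, Continuous fun t => U t e

/-- `U` implements `u`: `U_t a U_t* = u_t(a)` as operators on the module, for all `a`. -/
def Implements (U : ℝ → CorrModule ν lam pH →L[ℂ] CorrModule ν lam pH)
    (u : ℝ → ν.Alg pG →L[ℂ] ν.Alg pG) : Prop :=
  ∀ t a e, U t (leftMul a (U (-t) e)) = leftMul (u t a) e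

end CorrModule

end Correspondence

end

open TopologicalGroupoid

/-! ## Equivariance of extensions by continuity -/

/-! Everything rests on the additivity of `c`. In the convolution integral the phases of `f(ξ)` and
`g(ξ⁻¹η)` combine to `e^{itc(η)}`, which does not depend on `ξ`, so multiplication by `e^{itc}`
respects convolution (`HaarSystem.conv_phase`). It respects the involution because inversion and
conjugation each change the sign of the exponent (`Cocycle.invol_phase`). On `ker c` the phase is 1;
hence the inner product is invariant (`HaarSystem.innerKer_phase`) and the right action is
equivariant (`HaarSystem.rightAct_phase`).

Two analytic facts lift this to the completions. First, the phase preserves each norm: it permutes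
the admissible representations, it is isometric for the `L²` norm that defines the reduced norm, and
it fixes `⟨Φ, Φ⟩`. Second, orbits are norm continuous: `t ↦ e^{itc}f` is Lipschitz in the supremum
norm with supports inside that of `f`, and there the supremum norm controls the `I`-norm, which
dominates both `C*`-norms. For the full norm this domination is part of the definition; for the
reduced norm it is a Schur test (`HaarSystem.integral_norm_conv_sq_le`).

Each identity on `C_c` passes to the extended operations by `limitExtension_equivariant`, which
needs no existence of limits: a symmetry carries limits to limits, and where there is none both
sides take the default value 0. Boundedness of the product, the inner product and the actions
therefore never enters. Similarly, the greatest seminorm below `N` inherits the symmetries and upper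
bounds of `N`, whether or not `N` is itself a seminorm. -/

/-- Extension by continuity commutes with homeomorphisms that lift bijections of the domain. -/
theorem limitExtension_equivariant {α β γ : Type*} [TopologicalSpace β] [TopologicalSpace γ]
    [T2Space γ] [Zero γ] {i : α → β} (hi : DenseRange i) {f : α → γ} (e : α ≃ α) (E : β ≃ₜ β)
    (F : γ ≃ₜ γ) (hF : F 0 = 0) (hE : ∀ a, i (e a) = E (i a)) (hf : ∀ a, f (e a) = F (f a))
    (b : β) : limitExtension i f (E b) = F (limitExtension i f b) := by
  -- The filter along which the limit at `E b` is taken is the `e`-image of the one at `b`, so the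
  -- two limit problems correspond under `F`.
  have hcomap : comap i (𝓝 (E b)) = map e (comap i (𝓝 b)) := by
    have h : E.symm ∘ i = i ∘ e.symm := by
      funext a
      have := hE (e.symm a)
      rw [Equiv.apply_symm_apply] at this
      simp [this]
    rw [← Filter.comap_equiv_symm, comap_comap, ← h, ← comap_comap, E.symm.comap_nhds_eq,
      Homeomorph.symm_symm]
  have hne : ∀ b, (comap i (𝓝 b)).NeBot := fun b =>
    comap_neBot_iff_frequently.mpr (mem_closure_iff_frequently.mp (hi b))
  have key : ∀ y, Tendsto f (comap i (𝓝 (E b))) (𝓝 (F y)) ↔ Tendsto f (comap i (𝓝 b)) (𝓝 y) := by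
    intro y
    rw [hcomap, tendsto_map'_iff, show f ∘ e = F ∘ f from funext hf]
    exact F.isInducing.tendsto_nhds_iff.symm
  by_cases h : ∃ y, Tendsto f (comap i (𝓝 b)) (𝓝 y)
  · have h' : ∃ y, Tendsto f (comap i (𝓝 (E b))) (𝓝 y) := ⟨_, (key _).2 h.choose_spec⟩
    rw [limitExtension, limitExtension, dif_pos h, dif_pos h']
    have := hne (E b)
    -- Density of `i` makes the filter nontrivial, so the chosen limit is the only one.
    exact tendsto_nhds_unique h'.choose_spec ((key _).2 h.choose_spec)
  · have h' : ¬ ∃ y, Tendsto f (comap i (𝓝 (E b))) (𝓝 y) := by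
      rintro ⟨y, hy⟩
      exact h ⟨F.symm y, (key _).1 (by simpa using hy)⟩
    rw [limitExtension, limitExtension, dif_neg h, dif_neg h', hF]

/-! ### Isometric flows on a seminormed space and their extension to the completion -/

section Flow

variable {V : Type u} [AddCommGroup V] [Module ℂ V]

theorem norm_toCompletion (p : Seminorm ℂ V) (v : V) : ‖toCompletion p v‖ = p v :=
  UniformSpace.Completion.norm_coe (E := WithSeminorm p) v

theorem denseRange_toCompletion (p : Seminorm ℂ V) : DenseRange (toCompletion p) :=
  UniformSpace.Completion.denseRange_coe (α := WithSeminorm p)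

/-- `toCompletion` as a linear map. -/
noncomputable def toCompletionₗ (p : Seminorm ℂ V) : V →ₗ[ℂ] SeminormCompletion p where
  toFun := toCompletion p
  map_add' v w := UniformSpace.Completion.coe_add (α := WithSeminorm p) v w
  map_smul' z v := UniformSpace.Completion.coe_smul (X := WithSeminorm p) z v

/-- The family is bounded pointwise by `N`, so its supremum in the lattice of seminorms is computed
pointwise. -/
theorem greatestSeminorm_le {N : V → ℝ} (h : ∀ v, 0 ≤ N v) (v : V) : greatestSeminorm N v ≤ N v := by
  have hb : BddAbove {p : Seminorm ℂ V | ∀ v, p v ≤ N v} :=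
    Seminorm.bddAbove_iff.mpr ⟨N, by rintro _ ⟨p, hp, rfl⟩ v; exact hp v⟩
  rw [greatestSeminorm, Seminorm.sSup_apply hb]
  exact Real.iSup_le (fun p => p.2 v) (h v)

/-- Pulling the greatest seminorm back along `T⁻¹` gives another seminorm below the invariant
function `N`; maximality, evaluated at `T v`, is the claim. -/
theorem greatestSeminorm_comp_le {N : V → ℝ} (h : ∀ v, 0 ≤ N v) (T : V ≃ₗ[ℂ] V)
    (hT : ∀ v, N (T v) = N v) (v : V) : greatestSeminorm N v ≤ greatestSeminorm N (T v) := by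
  have hb : BddAbove {p : Seminorm ℂ V | ∀ v, p v ≤ N v} :=
    Seminorm.bddAbove_iff.mpr ⟨N, by rintro _ ⟨p, hp, rfl⟩ v; exact hp v⟩
  have hmem : (greatestSeminorm N).comp T.symm.toLinearMap ∈
      {p : Seminorm ℂ V | ∀ v, p v ≤ N v} := fun w => by
    have := greatestSeminorm_le h (T.symm w)
    rwa [← hT, T.apply_symm_apply] at this
  have := le_csSup hb hmem (T v)
  simpa [greatestSeminorm] using this

/-- The greatest seminorm below `N` inherits the symmetries of `N`. -/
theorem greatestSeminorm_comp {N : V → ℝ} (h : ∀ v, 0 ≤ N v) (T : V ≃ₗ[ℂ] V)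
    (hT : ∀ v, N (T v) = N v) (v : V) : greatestSeminorm N (T v) = greatestSeminorm N v := by
  refine le_antisymm ?_ (greatestSeminorm_comp_le h T hT v)
  have := greatestSeminorm_comp_le h T.symm (fun w => by rw [← hT, T.apply_symm_apply]) (T v)
  rwa [T.symm_apply_apply] at this

/-- One-parameter groups of linear isometries for a seminorm `p`, strongly continuous for `p`. -/
structure Seminorm.IsIsometricFlow (p : Seminorm ℂ V) (T : ℝ → V ≃ₗ[ℂ] V) : Prop where
  zero : ∀ v, T 0 v = v
  add : ∀ s t v, T (s + t) v = T s (T t v)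
  isometry : ∀ t v, p (T t v) = p v
  continuous : ∀ v s, Tendsto (fun t => p (T t v - T s v)) (𝓝 s) (𝓝 0)

namespace Seminorm.IsIsometricFlow

variable {p : Seminorm ℂ V} {T : ℝ → V ≃ₗ[ℂ] V} (hT : p.IsIsometricFlow T)

/-- The extension of an isometric flow to the completion. -/
noncomputable def extend (hT : p.IsIsometricFlow T) (t : ℝ) : SeminormCompletion p ≃ₗᵢ[ℂ] SeminormCompletion p :=
  (T t).extendOfIsometry (toCompletionₗ p) (toCompletionₗ p) (denseRange_toCompletion p)
    (denseRange_toCompletion p)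
    fun v => by
      change ‖toCompletion p (T t v)‖ = ‖toCompletion p v‖
      rw [norm_toCompletion, norm_toCompletion, hT.isometry]

theorem extend_toCompletion (t : ℝ) (v : V) :
    hT.extend t (toCompletion p v) = toCompletion p (T t v) :=
  LinearEquiv.extendOfIsometry_eq (T t) (toCompletionₗ p) (toCompletionₗ p)
    (denseRange_toCompletion p) (denseRange_toCompletion p) _ v

theorem extend_zero (a : SeminormCompletion p) : hT.extend 0 a = a := by
  refine (denseRange_toCompletion p).induction_on a
    (isClosed_eq (hT.extend 0).continuous continuous_id) fun v => ?_
  rw [extend_toCompletion, hT.zero]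

theorem extend_add (s t : ℝ) (a : SeminormCompletion p) :
    hT.extend (s + t) a = hT.extend s (hT.extend t a) := by
  refine (denseRange_toCompletion p).induction_on a
    (isClosed_eq (hT.extend _).continuous
      ((hT.extend s).continuous.comp (hT.extend t).continuous)) fun v => ?_
  rw [extend_toCompletion, extend_toCompletion, extend_toCompletion, hT.add]

theorem extend_neg_apply (t : ℝ) (a : SeminormCompletion p) :
    hT.extend t (hT.extend (-t) a) = a := by
  rw [← extend_add, add_neg_cancel, extend_zero]

theorem extend_apply_neg (t : ℝ) (a : SeminormCompletion p) :
    hT.extend (-t) (hT.extend t a) = a := by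
  rw [← extend_add, neg_add_cancel, extend_zero]

/-- Since every map is an isometry, approximating `a` by a vector of `V` approximates its whole
orbit uniformly in `t`, and uniform limits of continuous orbits are continuous. -/
theorem continuous_extend (a : SeminormCompletion p) : Continuous fun t => hT.extend t a := by
  refine continuous_of_uniform_approx_of_continuous fun w hw => ?_
  obtain ⟨ε, hε, hεw⟩ := Metric.mem_uniformity_dist.mp hw
  obtain ⟨v, hv⟩ := (denseRange_toCompletion p).exists_dist_lt a hε
  refine ⟨fun t => hT.extend t (toCompletion p v), ?_, fun t => hεw ?_⟩
  · rw [continuous_iff_continuousAt]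
    intro s
    rw [ContinuousAt, tendsto_iff_norm_sub_tendsto_zero]
    refine (hT.continuous v s).congr fun t => ?_
    rw [extend_toCompletion, extend_toCompletion, ← norm_toCompletion]
    exact congrArg norm ((toCompletionₗ p).map_sub _ _)
  · rwa [(hT.extend t).dist_map]

end Seminorm.IsIsometricFlow

variable {W X : Type u} [AddCommGroup W] [Module ℂ W] [AddCommGroup X] [Module ℂ X]
  {p : Seminorm ℂ V} {q : Seminorm ℂ W} {s : Seminorm ℂ X} {B : V → W → X}

/-- The extension by continuity of a map of two variables is equivariant as soon as the map is. -/
theorem limitExtension₂_equivariant {e₁ : V ≃ V} {e₂ : W ≃ W} {e₃ : X → X}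
    (E₁ : SeminormCompletion p ≃ₗᵢ[ℂ] SeminormCompletion p)
    (E₂ : SeminormCompletion q ≃ₗᵢ[ℂ] SeminormCompletion q)
    (E₃ : SeminormCompletion s ≃ₗᵢ[ℂ] SeminormCompletion s)
    (h₁ : ∀ v, E₁ (toCompletion p v) = toCompletion p (e₁ v))
    (h₂ : ∀ w, E₂ (toCompletion q w) = toCompletion q (e₂ w))
    (h₃ : ∀ x, E₃ (toCompletion s x) = toCompletion s (e₃ x))
    (hB : ∀ v w, B (e₁ v) (e₂ w) = e₃ (B v w))
    (a : SeminormCompletion p) (b : SeminormCompletion q) :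
    limitExtension₂ p q s B (E₁ a) (E₂ b) = E₃ (limitExtension₂ p q s B a b) :=
  limitExtension_equivariant
    ((denseRange_toCompletion p).prodMap (denseRange_toCompletion q)) (e₁.prodCongr e₂)
    (E₁.toHomeomorph.prodCongr E₂.toHomeomorph) E₃.toHomeomorph (map_zero E₃)
    (fun x => Prod.ext (h₁ x.1).symm (h₂ x.2).symm)
    (fun x => by
      change toCompletion s (B (e₁ x.1) (e₂ x.2)) = E₃ (toCompletion s (B x.1 x.2))
      rw [hB, h₃]) (a, b)

end Flow

/-! ## Groupoid identities -/

namespace TopologicalGroupoid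

variable {G : Type u} [TopologicalSpace G] [TopologicalGroupoid G]

theorem evalMul_of_composable (f : G → ℂ) {ξ η : G} (h : d ξ = r η) :
    evalMul f ξ η = f (mul ξ η h) := dif_pos h

theorem inv_mul_mul (η ξ : G) (h : d η = r ξ) :
    mul (inv η) (mul η ξ h) ((d_inv η).trans (r_mul _ _ _).symm) = ξ := by
  have := mul_inv_mul (inv η) ξ ((d_inv _).trans ((r_inv η).trans h))
  simpa only [inv_inv'] using this

/-- The product of `ξ⁻¹η⁻¹` with `ηξ` telescopes to the unit `d ξ`; multiplying on the right by
`(ηξ)⁻¹` identifies the two inverses. -/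
theorem inv_mul (η ξ : G) (h : d η = r ξ) :
    inv (mul η ξ h) = mul (inv ξ) (inv η) ((d_inv ξ).trans (h.symm.trans (r_inv η).symm)) := by
  have hq : d (mul (inv ξ) (inv η) ((d_inv ξ).trans (h.symm.trans (r_inv η).symm))) =
      r (mul η ξ h) := by rw [d_mul, d_inv, r_mul]
  have h1 := mul_mul_inv _ _ hq
  have h2 := assoc (inv ξ) (inv η) (mul η ξ h) ((d_inv ξ).trans (h.symm.trans (r_inv η).symm))
    ((d_inv η).trans (r_mul _ _ _).symm)
  simp only [inv_mul_mul, inv_comp] at h2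
  have h3 := unit_mul (inv (mul η ξ h))
  simp only [r_inv, d_mul] at h3
  simp only [h2, h3] at h1
  exact h1

theorem inv_mul_mul_eq_inv (ζ ξ : G) (h : d ζ = r ξ) :
    mul (inv (mul ζ ξ h)) ζ ((d_inv _).trans (r_mul _ _ _)) = inv ξ := by
  have h1 := mul_mul_inv (inv ξ) (inv ζ) ((d_inv ξ).trans (h.symm.trans (r_inv ζ).symm))
  simp only [← inv_mul ζ ξ h, inv_inv'] at h1
  exact h1

theorem sourceUnit_eq_rangeUnit_inv (η : G) : rangeUnit (inv η) = sourceUnit η :=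
  Subtype.ext (r_inv η)

theorem rangeUnit_eq {ξ : G} {x : UnitSpace G} (h : r ξ = (x : G)) : rangeUnit ξ = x :=
  Subtype.ext h

theorem isCompact_preimage_inv {K : Set G} (hK : IsCompact K) : IsCompact (inv ⁻¹' K) :=
  (invHomeo G).isCompact_preimage.mpr hK

end TopologicalGroupoid

/-! ## Equivariance of the operations under phase multiplication -/

namespace Cocycle

variable {G : Type u} [TopologicalSpace G] [TopologicalGroupoid G] (c : Cocycle G)

theorem phase_apply (t : ℝ) (f : C_c(G, ℂ)) (ξ : G) :
    c.phase t f ξ = Complex.exp (Complex.I * t * c ξ) * f ξ := rfl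

theorem norm_exp_phase (t x : ℝ) : ‖Complex.exp (Complex.I * t * x)‖ = 1 := by
  rw [mul_assoc, ← Complex.ofReal_mul, Complex.norm_exp_I_mul_ofReal]

theorem norm_phase (t : ℝ) (f : C_c(G, ℂ)) (ξ : G) : ‖c.phase t f ξ‖ = ‖f ξ‖ := by
  rw [phase_apply, norm_mul, norm_exp_phase, one_mul]

theorem phase_zero (f : C_c(G, ℂ)) : c.phase 0 f = f := by
  ext ξ
  simp [phase_apply]

theorem phase_add (s t : ℝ) (f : C_c(G, ℂ)) : c.phase (s + t) f = c.phase s (c.phase t f) := by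
  ext ξ
  rw [phase_apply, phase_apply, phase_apply, ← mul_assoc, ← Complex.exp_add]
  push_cast
  ring_nf

/-- Phase multiplication as a linear automorphism of `C_c(G)`. -/
noncomputable def phaseEquiv (t : ℝ) : C_c(G, ℂ) ≃ₗ[ℂ] C_c(G, ℂ) where
  toFun := c.phase t
  invFun := c.phase (-t)
  left_inv f := by rw [← phase_add, neg_add_cancel, phase_zero]
  right_inv f := by rw [← phase_add, add_neg_cancel, phase_zero]
  map_add' f g := by
    ext ξ
    exact mul_add _ _ _
  map_smul' z f := by
    ext ξ
    exact mul_left_comm _ _ _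

theorem phaseEquiv_apply (t : ℝ) (f : C_c(G, ℂ)) : c.phaseEquiv t f = c.phase t f := rfl

theorem tsupport_phase_subset (t : ℝ) (f : C_c(G, ℂ)) : tsupport (c.phase t f) ⊆ tsupport f :=
  tsupport_mul_subset_right

theorem evalMul_phase (t : ℝ) (f : C_c(G, ℂ)) (ξ η : G) :
    evalMul (c.phase t f) ξ η = Complex.exp (Complex.I * t * (c ξ + c η)) * evalMul f ξ η := by
  unfold evalMul
  split_ifs with h
  · rw [phase_apply, c.map_mul, Complex.ofReal_add]
  · rw [mul_zero]

/-- Conjugation negates the exponent, and `c(ξ⁻¹) = -c(ξ)` negates it back. -/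
theorem invol_phase (t : ℝ) (f : C_c(G, ℂ)) : invol (c.phase t f) = c.phase t (invol f) := by
  ext ξ
  change starRingEnd ℂ (c.phase t f (inv ξ)) = _ * starRingEnd ℂ (f (inv ξ))
  rw [phase_apply, _root_.map_mul, ← Complex.exp_conj, c.map_inv]
  simp

/-- `t ↦ e^{itc} f` is Lipschitz in the supremum norm. -/
theorem exists_norm_phase_sub_le (f : C_c(G, ℂ)) :
    ∃ M : ℝ, 0 ≤ M ∧ ∀ (s t : ℝ) (ξ : G), ‖(c.phase t f - c.phase s f) ξ‖ ≤ |t - s| * M := by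
  -- The Lipschitz constant is a bound for `|c f|`, because `|e^{ia} - 1| ≤ |a|`; although `c` may
  -- be unbounded, `c f` has compact support.
  obtain ⟨M, hM⟩ := (f.hasCompactSupport.mul_left (f := fun ξ => (c ξ : ℂ))
    ).exists_bound_of_continuous (by have := c.continuous_toFun; fun_prop)
  refine ⟨max M 0, le_max_right _ _, fun s t ξ => ?_⟩
  have h : (c.phase t f - c.phase s f) ξ = Complex.exp (Complex.I * s * c ξ) *
      ((Complex.exp (Complex.I * ((t - s) * c ξ : ℝ)) - 1) * f ξ) := by
    change c.phase t f ξ - c.phase s f ξ = _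
    rw [phase_apply, phase_apply, sub_mul, mul_sub, ← mul_assoc, ← Complex.exp_add, one_mul]
    push_cast
    ring_nf
  rw [h, norm_mul, norm_exp_phase, one_mul, norm_mul]
  calc _ ≤ ‖(t - s) * c ξ‖ * ‖f ξ‖ := by
        gcongr
        exact Real.norm_exp_I_mul_ofReal_sub_one_le
    _ = |t - s| * ‖(c ξ : ℂ) * f ξ‖ := by
        rw [norm_mul, norm_mul, Complex.norm_real, Real.norm_eq_abs, mul_assoc]
    _ ≤ |t - s| * max M 0 := by
        gcongr
        exact (hM ξ).trans (le_max_left _ _)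

/-- Keeps all differences along an orbit in one compact set, so that the constants in the norm
estimates do not depend on `t`. -/
theorem phase_sub_eq_zero {f : C_c(G, ℂ)} {ξ : G} (hξ : ξ ∉ tsupport f) (s t : ℝ) :
    (c.phase t f - c.phase s f) ξ = 0 := by
  change c.phase t f ξ - c.phase s f ξ = 0
  rw [phase_apply, phase_apply, image_eq_zero_of_notMem_tsupport hξ, mul_zero, mul_zero, sub_zero]

end Cocycle

section PhaseOperations

variable {G : Type u} [TopologicalSpace G] [T2Space G] [LocallyCompactSpace G]
  [MeasurableSpace G] [BorelSpace G] [TopologicalGroupoid G] (ν : HaarSystem G) (c : Cocycle G)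

/-- Since `c(ξ) + c(ξ⁻¹) + c(η) = c(η)`, the total phase of the integrand is constant in `ξ` and
leaves the integral. -/
theorem HaarSystem.conv_phase (t : ℝ) (f g : C_c(G, ℂ)) :
    ν.conv (c.phase t f) (c.phase t g) = c.phase t (ν.conv f g) := by
  ext η
  change ∫ ξ, c.phase t f ξ * evalMul (c.phase t g) (inv ξ) η ∂ν.ν (rangeUnit η) =
    Complex.exp (Complex.I * t * c η) * ∫ ξ, f ξ * evalMul g (inv ξ) η ∂ν.ν (rangeUnit η)
  rw [← integral_const_mul]
  congr 1
  ext ξ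
  have h : Complex.exp (Complex.I * t * c η) = Complex.exp (Complex.I * t * c ξ) *
      Complex.exp (Complex.I * t * (c (inv ξ) + c η)) := by
    rw [← Complex.exp_add, c.map_inv]
    push_cast
    ring_nf
  rw [c.evalMul_phase, c.phase_apply, h]
  ring

/-- The inner product is `Φ* * Ψ` restricted to `ker c`, where the phase acquired by the convolution
equals 1. -/
theorem HaarSystem.innerKer_phase (t : ℝ) (Φ Ψ : C_c(G, ℂ)) :
    ν.innerKer c (c.phase t Φ) (c.phase t Ψ) = ν.innerKer c Φ Ψ := by
  ext χ
  unfold innerKer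
  rw [c.invol_phase, ν.conv_phase]
  change Complex.exp (Complex.I * t * c χ.1) * _ = _
  rw [χ.2]
  simp only [Complex.ofReal_zero, mul_zero, Complex.exp_zero, one_mul]
  rfl

variable {c}

/-- For `χ` in `ker c` one has `c(zχ) = c(z)`, so the phase is constant in the integration variable.
-/
theorem HaarSystem.rightAct_phase (lam : HaarSystem c.Ker) (t : ℝ) (Φ : C_c(G, ℂ))
    (h : C_c(c.Ker, ℂ)) : lam.rightAct (c.phase t Φ) h = c.phase t (lam.rightAct Φ h) := by
  ext z
  change ∫ χ, evalMul (c.phase t Φ) z (c.incl χ) * h (inv χ) ∂lam.ν (c.kerSourceUnit z) =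
    Complex.exp (Complex.I * t * c z) *
      ∫ χ, evalMul Φ z (c.incl χ) * h (inv χ) ∂lam.ν (c.kerSourceUnit z)
  rw [← integral_const_mul]
  congr 1
  ext χ
  have hχ : c (c.incl χ) = 0 := χ.2
  rw [c.evalMul_phase, hχ, Complex.ofReal_zero, add_zero, mul_assoc]

end PhaseOperations

/-! ## Estimates in the `I`-norm -/

section Estimates

variable {G : Type u} [TopologicalSpace G] [T2Space G] [LocallyCompactSpace G]
  [MeasurableSpace G] [BorelSpace G] [TopologicalGroupoid G] (ν : HaarSystem G)

/-- The measures of a Haar system are uniformly bounded on a compact set. -/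
theorem HaarSystem.exists_integral_norm_le {K : Set G} (hK : IsCompact K) :
    ∃ M : ℝ, 0 ≤ M ∧ ∀ (x : UnitSpace G) (g : G → ℂ) (s : ℝ), (∀ ξ, ξ ∉ K → g ξ = 0) →
      (∀ ξ, ‖g ξ‖ ≤ s) → ∫ ξ, ‖g ξ‖ ∂ν.ν x ≤ M * s := by
  obtain ⟨θ, hθ1, hθ⟩ := exists_cutoff hK
  -- As `ν x` lives on `r⁻¹(x)`, the continuous function `x ↦ ∫ θ dν^x` vanishes off the compact set
  -- `r(supp θ)`; it is therefore bounded, and `s θ` dominates `|g|`.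
  have hsupp : HasCompactSupport fun x => ∫ ξ, θ ξ ∂ν.ν x := by
    refine HasCompactSupport.intro (K := rangeUnit '' tsupport θ)
      (θ.hasCompactSupport.isCompact.image (continuous_r.subtype_mk _)) fun x hx => ?_
    refine integral_eq_zero_of_ae ?_
    filter_upwards [ν.ae_mem_fibre x] with ξ hξ
    exact image_eq_zero_of_notMem_tsupport fun h => hx ⟨ξ, h, rangeUnit_eq hξ⟩
  obtain ⟨M, hM⟩ := hsupp.exists_bound_of_continuous (ν.continuous_integral θ)
  refine ⟨max M 0, le_max_right _ _, fun x g s hg hs => ?_⟩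
  have hθnorm : ∫ ξ, ‖θ ξ‖ ∂ν.ν x ≤ M := by
    have h1 : ∀ ξ, θ ξ = ((‖θ ξ‖ : ℝ) : ℂ) := fun ξ => by
      obtain ⟨s, hs, h⟩ := hθ ξ
      rw [h, Complex.norm_real, Real.norm_of_nonneg hs]
    have h2 : ∫ ξ, θ ξ ∂ν.ν x = ((∫ ξ, ‖θ ξ‖ ∂ν.ν x : ℝ) : ℂ) := by
      rw [← integral_complex_ofReal]
      exact integral_congr_ae (Eventually.of_forall h1)
    have h3 := hM x
    rwa [h2, Complex.norm_real,
      Real.norm_of_nonneg (integral_nonneg fun _ => norm_nonneg _)] at h3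
  rcases isEmpty_or_nonempty G with hG | ⟨⟨ξ₀⟩⟩
  · exact isEmptyElim (x : G)
  have hs0 : 0 ≤ s := (norm_nonneg _).trans (hs ξ₀)
  calc ∫ ξ, ‖g ξ‖ ∂ν.ν x ≤ ∫ ξ, s * ‖θ ξ‖ ∂ν.ν x := by
        refine integral_mono_of_nonneg (Eventually.of_forall fun _ => norm_nonneg _)
          ((ν.integrable x θ).norm.const_mul s) (Eventually.of_forall fun ξ => ?_)
        by_cases hk : ξ ∈ K
        · simpa [hθ1 ξ hk] using hs ξ
        · simp only [hg ξ hk, norm_zero]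
          positivity
    _ = s * ∫ ξ, ‖θ ξ‖ ∂ν.ν x := integral_const_mul _ _
    _ ≤ max M 0 * s := by
        rw [mul_comm]
        gcongr
        exact hθnorm.trans (le_max_left _ _)

/-- A continuous, compactly supported function has bounded fibre integrals. -/
theorem HaarSystem.bddAbove_integral_norm {g : G → ℂ} (hg : Continuous g)
    (hg' : HasCompactSupport g) : BddAbove (Set.range fun x => ∫ ξ, ‖g ξ‖ ∂ν.ν x) := by
  obtain ⟨M, -, hM⟩ := ν.exists_integral_norm_le hg'.isCompact
  obtain ⟨s, hs⟩ := hg'.exists_bound_of_continuous hg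
  refine ⟨M * s, ?_⟩
  rintro _ ⟨x, rfl⟩
  exact hM x g s (fun ξ hξ => image_eq_zero_of_notMem_tsupport hξ) hs

theorem hasCompactSupport_comp_inv (f : C_c(G, ℂ)) : HasCompactSupport fun ξ => f (inv ξ) :=
  f.hasCompactSupport.comp_homeomorph (invHomeo G)

theorem continuous_comp_inv (f : C_c(G, ℂ)) : Continuous fun ξ => f (inv ξ) :=
  f.continuous.comp continuous_inversion

theorem HaarSystem.normI_nonneg (f : C_c(G, ℂ)) : 0 ≤ ν.normI f :=
  le_max_of_le_left (Real.iSup_nonneg fun _ => integral_nonneg fun _ => norm_nonneg _)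

theorem HaarSystem.integral_norm_le_normI (f : C_c(G, ℂ)) (x : UnitSpace G) :
    ∫ ξ, ‖f ξ‖ ∂ν.ν x ≤ ν.normI f :=
  le_max_of_le_left
    (le_ciSup (ν.bddAbove_integral_norm f.continuous f.hasCompactSupport) x)

theorem HaarSystem.integral_norm_inv_le_normI (f : C_c(G, ℂ)) (x : UnitSpace G) :
    ∫ ξ, ‖f (inv ξ)‖ ∂ν.ν x ≤ ν.normI f :=
  le_max_of_le_right
    (le_ciSup (ν.bddAbove_integral_norm (continuous_comp_inv f) (hasCompactSupport_comp_inv f)) x)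

/-- On functions supported in a fixed compact set, the `I`-norm is controlled by the supremum
norm. -/
theorem HaarSystem.exists_normI_le {K : Set G} (hK : IsCompact K) :
    ∃ M : ℝ, 0 ≤ M ∧ ∀ (f : C_c(G, ℂ)) (s : ℝ), 0 ≤ s → (∀ ξ, ξ ∉ K → f ξ = 0) →
      (∀ ξ, ‖f ξ‖ ≤ s) → ν.normI f ≤ M * s := by
  -- Adding `K⁻¹` to `K` lets a single constant serve both fibre integrals in the `I`-norm.
  obtain ⟨M, hM0, hM⟩ := ν.exists_integral_norm_le (hK.union (isCompact_preimage_inv hK))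
  refine ⟨M, hM0, fun f s hs0 hf hs => max_le ?_ ?_⟩
  · exact Real.iSup_le (fun x => hM x f s (fun ξ hξ => hf ξ fun h => hξ (Or.inl h)) hs)
      (by positivity)
  · exact Real.iSup_le (fun x => hM x (fun ξ => f (inv ξ)) s
      (fun ξ hξ => hf _ fun h => hξ (Or.inr h)) fun ξ => hs _) (by positivity)

theorem HaarSystem.full_le_normI (f : C_c(G, ℂ)) : ν.full f ≤ ν.normI f := by
  refine Real.sSup_le ?_ (ν.normI_nonneg f)
  rintro x ⟨K, i1, i2, i3, π, hπ, rfl⟩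
  exact hπ.norm_le f

/-- The supremum norm of a convolution product, for functions supported in a fixed compact set. -/
theorem HaarSystem.exists_norm_conv_le {K : Set G} (hK : IsCompact K) :
    ∃ M : ℝ, 0 ≤ M ∧ ∀ (f g : C_c(G, ℂ)) (s t : ℝ), 0 ≤ t → (∀ ξ, ξ ∉ K → f ξ = 0) →
      (∀ ξ, ‖f ξ‖ ≤ s) → (∀ ξ, ‖g ξ‖ ≤ t) → ∀ η, ‖ν.conv f g η‖ ≤ M * (s * t) := by
  obtain ⟨M, hM0, hM⟩ := ν.exists_integral_norm_le hK
  refine ⟨M, hM0, fun f g s t ht hf hs hg η => ?_⟩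
  refine (norm_integral_le_integral_norm _).trans
    (hM (rangeUnit η) (fun ξ => f ξ * evalMul g (inv ξ) η) (s * t)
      (fun ξ hξ => by rw [hf ξ hξ, zero_mul]) fun ξ => ?_)
  rw [norm_mul]
  refine mul_le_mul (hs ξ) ?_ (norm_nonneg _) ((norm_nonneg _).trans (hs ξ))
  unfold evalMul
  split_ifs
  · exact hg _
  · rwa [norm_zero]

theorem HaarSystem.conv_eq_zero (f g : C_c(G, ℂ)) {K L : Set G} (hf : ∀ ξ, ξ ∉ K → f ξ = 0)
    (hg : ∀ ξ, ξ ∉ L → g ξ = 0) {η : G} (hη : η ∉ prodSet K L) : ν.conv f g η = 0 := by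
  refine integral_eq_zero_of_ae (Eventually.of_forall fun ξ => ?_)
  by_contra hne
  have h1 : f ξ ≠ 0 := left_ne_zero_of_mul hne
  have h2 : evalMul g (inv ξ) η ≠ 0 := right_ne_zero_of_mul hne
  unfold evalMul at h2
  split_ifs at h2 with h
  · refine hη ?_
    rw [← mul_inv_mul ξ η h]
    exact mem_prodSet _ (not_not.mp fun hk => h1 (hf _ hk)) (not_not.mp fun hk => h2 (hg _ hk))
  · exact h2 rfl

end Estimates

/-! ## The reduced norm is dominated by the `I`-norm -/

section Reduced

/-- The Cauchy–Schwarz inequality for a weight `a`. -/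
theorem sq_integral_mul_le {α : Type*} [MeasurableSpace α] {μ : Measure α} {a k : α → ℝ}
    (ha : ∀ x, 0 ≤ a x) (h0 : Integrable a μ) (h1 : Integrable (fun x => a x * k x) μ)
    (h2 : Integrable (fun x => a x * k x ^ 2) μ) :
    (∫ x, a x * k x ∂μ) ^ 2 ≤ (∫ x, a x ∂μ) * ∫ x, a x * k x ^ 2 ∂μ := by
  -- The quadratic polynomial `t ↦ ∫ a (t - k)²` is nonnegative, so its discriminant is at most 0.
  have key : ∀ t : ℝ, 0 ≤ (∫ x, a x ∂μ) * (t * t) + (-2 * ∫ x, a x * k x ∂μ) * t +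
      ∫ x, a x * k x ^ 2 ∂μ := fun t => by
    have h : ∫ x, a x * (t - k x) ^ 2 ∂μ = (∫ x, a x ∂μ) * (t * t) +
        (-2 * ∫ x, a x * k x ∂μ) * t + ∫ x, a x * k x ^ 2 ∂μ := by
      have he : (fun x => a x * (t - k x) ^ 2) = fun x =>
          (t * t) * a x + (-2 * t) * (a x * k x) + a x * k x ^ 2 := by
        funext x
        ring
      have h3 : Integrable (fun x => (t * t) * a x) μ := h0.const_mul _
      have h4 : Integrable (fun x => (-2 * t) * (a x * k x)) μ := h1.const_mul _
      have h5 : Integrable (fun x => (t * t) * a x + (-2 * t) * (a x * k x)) μ := h3.add h4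
      rw [he, integral_add h5 h2, integral_add h3 h4, integral_const_mul, integral_const_mul]
      ring
    rw [← h]
    exact integral_nonneg fun x => mul_nonneg (ha x) (sq_nonneg _)
  have := discrim_le_zero key
  rw [discrim] at this
  linarith

variable {G : Type u} [TopologicalSpace G] [T2Space G] [LocallyCompactSpace G]
  [MeasurableSpace G] [BorelSpace G] [TopologicalGroupoid G] (ν : HaarSystem G)

theorem isClosed_fibre (x : G) : IsClosed {ξ : G | r ξ = x} :=
  isClosed_eq continuous_r continuous_const

/-- The measure `ν x` sees only the closed fibre `r⁻¹(x)`, where `φ` agrees with a function in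
`C_c(G)`. Integrands built from `evalMul` need not be continuous off the fibre. -/
theorem HaarSystem.integrable_of_continuousOn {x : UnitSpace G} {φ : G → ℝ} {K : Set G}
    (hK : IsCompact K) (hφ : ContinuousOn φ {ξ | r ξ = (x : G)})
    (h0 : ∀ ξ, r ξ = (x : G) → ξ ∉ K → φ ξ = 0) : Integrable φ (ν.ν x) := by
  obtain ⟨g, hg⟩ := exists_extension_of_closed (isClosed_fibre (x : G)) hK
    (φ := fun ξ => (φ ξ : ℂ)) (Complex.continuous_ofReal.comp_continuousOn hφ)
    (fun ξ hξ hk => by rw [h0 ξ hξ hk, Complex.ofReal_zero])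
  refine (ν.integrable x g).re.congr ?_
  filter_upwards [ν.ae_mem_fibre x] with ξ hξ
  simp [hg ξ hξ]

/-- Left invariance, for real functions on a fibre. -/
theorem HaarSystem.integral_translate (η : G) {φ ψ : G → ℝ} {K : Set G} (hK : IsCompact K)
    (hφ : ContinuousOn φ {ξ | r ξ = r η}) (h0 : ∀ ξ, r ξ = r η → ξ ∉ K → φ ξ = 0)
    (hψ : ∀ ξ (h : d η = r ξ), ψ ξ = φ (mul η ξ h)) :
    ∫ ξ, φ ξ ∂ν.ν (rangeUnit η) = ∫ ξ, ψ ξ ∂ν.ν (sourceUnit η) := by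
  obtain ⟨g, hg⟩ := exists_extension_of_closed (isClosed_fibre (r η)) hK
    (φ := fun ξ => (φ ξ : ℂ)) (Complex.continuous_ofReal.comp_continuousOn hφ)
    (fun ξ hξ hk => by rw [h0 ξ hξ hk, Complex.ofReal_zero])
  have h := ν.invariant η g
  have h1 : ∫ ξ, g ξ ∂ν.ν (rangeUnit η) = ((∫ ξ, φ ξ ∂ν.ν (rangeUnit η) : ℝ) : ℂ) := by
    rw [← integral_complex_ofReal]
    refine integral_congr_ae ?_
    filter_upwards [ν.ae_mem_fibre (rangeUnit η)] with ξ hξ using hg ξ hξ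
  have h2 : ∫ ξ, evalMul g η ξ ∂ν.ν (sourceUnit η) =
      ((∫ ξ, ψ ξ ∂ν.ν (sourceUnit η) : ℝ) : ℂ) := by
    rw [← integral_complex_ofReal]
    refine integral_congr_ae ?_
    filter_upwards [ν.ae_mem_fibre (sourceUnit η)] with ξ hξ
    have hξ' : d η = r ξ := hξ.symm
    rw [evalMul_of_composable _ hξ', hg _ (r_mul _ _ _), hψ ξ hξ']
  rw [h1, h2] at h
  exact_mod_cast h

theorem mem_tsupport_of_evalMul_ne_zero {f : G → ℂ} {ξ η : G} (h : evalMul f ξ η ≠ 0) :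
    ∃ hc : d ξ = r η, mul ξ η hc ∈ tsupport f := by
  unfold evalMul at h
  split_ifs at h with hc
  · exact ⟨hc, subset_tsupport _ h⟩
  · exact absurd rfl h

variable (f Φ : C_c(G, ℂ))

/-- Pointwise Cauchy–Schwarz estimate for a convolution product. -/
theorem HaarSystem.norm_conv_inv_sq_le (η : G) :
    ‖ν.conv f Φ (inv η)‖ ^ 2 ≤ ν.normI f *
      ∫ ζ, ‖evalMul f (inv η) ζ‖ * ‖Φ (inv ζ)‖ ^ 2 ∂ν.ν (rangeUnit η) := by
  have hce : ContinuousOn (fun ξ => evalMul Φ (inv ξ) (inv η))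
      {ξ | r ξ = (sourceUnit η : G)} :=
    continuousOn_evalMul Φ.continuous continuous_inversion continuous_const fun ξ hξ =>
      (d_inv ξ).trans (Eq.trans hξ (r_inv η).symm)
  have hcf : ContinuousOn (fun ξ => ‖f ξ‖) {ξ | r ξ = (sourceUnit η : G)} :=
    f.continuous.norm.continuousOn
  have hK := f.hasCompactSupport.isCompact
  have hf0 : ∀ ξ, ξ ∉ tsupport f → ‖f ξ‖ = 0 := fun ξ hξ => by
    rw [image_eq_zero_of_notMem_tsupport hξ, norm_zero]
  have h1 : ‖ν.conv f Φ (inv η)‖ ≤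
      ∫ ξ, ‖f ξ‖ * ‖evalMul Φ (inv ξ) (inv η)‖ ∂ν.ν (sourceUnit η) := by
    rw [← sourceUnit_eq_rangeUnit_inv]
    simp only [← norm_mul]
    exact norm_integral_le_integral_norm _
  -- Only one factor `|f|` serves as weight: this leaves `∫ |f|`, bounded by the `I`-norm, times an
  -- integral linear in `|f|`.
  have h2 := sq_integral_mul_le (μ := ν.ν (sourceUnit η)) (a := fun ξ => ‖f ξ‖)
    (k := fun ξ => ‖evalMul Φ (inv ξ) (inv η)‖) (fun _ => norm_nonneg _)
    (ν.integrable _ f).norm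
    (ν.integrable_of_continuousOn hK (hcf.mul hce.norm)
      fun ξ _ hξ => by rw [hf0 ξ hξ, zero_mul])
    (ν.integrable_of_continuousOn hK (hcf.mul (hce.norm.pow 2))
      fun ξ _ hξ => by rw [hf0 ξ hξ, zero_mul])
  -- The substitution `ζ = ηξ` moves `η` into the argument of `f`, so that the factor in `Φ` depends
  -- on `ζ` alone.
  have h3 : ∫ ζ, ‖evalMul f (inv η) ζ‖ * ‖Φ (inv ζ)‖ ^ 2 ∂ν.ν (rangeUnit η) =
      ∫ ξ, ‖f ξ‖ * ‖evalMul Φ (inv ξ) (inv η)‖ ^ 2 ∂ν.ν (sourceUnit η) := by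
    refine ν.integral_translate η (isCompact_preimage_inv Φ.hasCompactSupport.isCompact)
      ?_ ?_ ?_
    · refine ContinuousOn.mul ?_ ((continuous_comp_inv Φ).norm.pow 2).continuousOn
      exact (continuousOn_evalMul f.continuous continuous_const continuous_id fun ξ hξ =>
        (d_inv η).trans (Eq.symm hξ)).norm
    · intro ζ _ hζ
      have : Φ (inv ζ) = 0 := image_eq_zero_of_notMem_tsupport hζ
      simp [this]
    · intro ξ h
      rw [evalMul_of_composable f ((d_inv η).trans (r_mul _ _ _).symm), inv_mul_mul,
        evalMul_of_composable Φ ((d_inv ξ).trans (h.symm.trans (r_inv η).symm)), inv_mul]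
  rw [h3]
  calc ‖ν.conv f Φ (inv η)‖ ^ 2 ≤ _ := pow_le_pow_left₀ (norm_nonneg _) h1 2
    _ ≤ _ := h2
    _ ≤ _ := by
      gcongr
      exact ν.integral_norm_le_normI f _

/-- Substituting `η = ζξ` turns `f(η⁻¹ζ)` into `f(ξ⁻¹)`, whose integral is controlled by the second
half of the `I`-norm. -/
theorem HaarSystem.integral_norm_evalMul_inv_le (ζ : G) :
    ∫ η, ‖evalMul f (inv η) ζ‖ ∂ν.ν (rangeUnit ζ) ≤ ν.normI f := by
  refine le_of_eq_of_le ?_ (ν.integral_norm_inv_le_normI f (sourceUnit ζ))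
  refine ν.integral_translate ζ (K := prodSet {ζ} (inv ⁻¹' tsupport f))
    (isCompact_prodSet isCompact_singleton
      (isCompact_preimage_inv f.hasCompactSupport.isCompact)) ?_ ?_ ?_
  · exact (continuousOn_evalMul f.continuous continuous_inversion continuous_const fun ξ hξ =>
      (d_inv ξ).trans hξ).norm
  · intro η _ hη
    by_contra hne
    obtain ⟨hc, hm⟩ := mem_tsupport_of_evalMul_ne_zero (norm_ne_zero_iff.mp hne)
    refine hη ?_
    have hc' : d ζ = r (inv (mul (inv η) ζ hc)) := by rw [r_inv, d_mul]
    have h : mul ζ (inv (mul (inv η) ζ hc)) hc' = η := by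
      have h1 := mul_inv_mul ζ η ((d_inv ζ).trans (hc.symm.trans (d_inv η)))
      simp only [inv_mul, inv_inv']
      exact h1
    rw [← h]
    refine mem_prodSet _ rfl ?_
    rwa [Set.mem_preimage, inv_inv']
  · intro ξ h
    rw [evalMul_of_composable f ((d_inv _).trans (r_mul _ _ _)), inv_mul_mul_eq_inv]

theorem HaarSystem.bddAbove_integral_sq :
    BddAbove (Set.range fun x => ∫ ξ, ‖Φ (inv ξ)‖ ^ 2 ∂ν.ν x) := by
  have h := ν.bddAbove_integral_norm (g := fun ξ => Φ (inv ξ) ^ 2) ((continuous_comp_inv Φ).pow 2)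
    ((hasCompactSupport_comp_inv Φ).comp_left (g := fun z : ℂ => z ^ 2) (by simp))
  simpa only [norm_pow] using h

/-- Convolution by `f` is bounded on `L²(G, ν)` by the `I`-norm of `f`. -/
theorem HaarSystem.integral_norm_conv_sq_le (x : UnitSpace G) :
    ∫ η, ‖ν.conv f Φ (inv η)‖ ^ 2 ∂ν.ν x ≤
      ν.normI f ^ 2 * ⨆ x, ∫ ξ, ‖Φ (inv ξ)‖ ^ 2 ∂ν.ν x := by
  have hreg := ν.regular x
  set L : Set G := inv ⁻¹' tsupport Φ
  have hL : IsCompact L := isCompact_preimage_inv Φ.hasCompactSupport.isCompact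
  set K : Set G := prodSet L (inv ⁻¹' tsupport f)
  have hK : IsCompact K :=
    isCompact_prodSet hL (isCompact_preimage_inv f.hasCompactSupport.isCompact)
  set S : Set (G × G) := {q | r q.1 = (x : G) ∧ r q.2 = (x : G)}
  have hS : IsClosed S :=
    ((isClosed_fibre (x : G)).preimage continuous_fst).inter
      ((isClosed_fibre (x : G)).preimage continuous_snd)
  set φ : G → G → ℝ := fun η ζ => ‖evalMul f (inv η) ζ‖ * ‖Φ (inv ζ)‖ ^ 2
  have hφc : ContinuousOn (fun q : G × G => φ q.1 q.2) S := by
    refine ContinuousOn.mul ?_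
      (((continuous_comp_inv Φ).comp continuous_snd).norm.pow 2).continuousOn
    exact (continuousOn_evalMul f.continuous (continuous_inversion.comp continuous_fst)
      continuous_snd fun q hq => (d_inv _).trans (hq.1.trans hq.2.symm)).norm
  -- If `ζ ∈ L` and `η⁻¹ζ` lies in the support of `f`, then `η = ζ(η⁻¹ζ)⁻¹` lies in `K`.
  have hφ0 : ∀ q ∈ S, q ∉ K ×ˢ L → φ q.1 q.2 = 0 := by
    intro q hq hqK
    by_contra hne
    have hΦ : q.2 ∈ L := by
      refine subset_tsupport _ fun h => right_ne_zero_of_mul hne ?_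
      rw [h, norm_zero, zero_pow two_ne_zero]
    obtain ⟨hc, hm⟩ := mem_tsupport_of_evalMul_ne_zero
      (norm_ne_zero_iff.mp (left_ne_zero_of_mul hne))
    refine hqK ⟨?_, hΦ⟩
    have hc' : d q.2 = r (inv (mul (inv q.1) q.2 hc)) := by rw [r_inv, d_mul]
    have h : mul q.2 (inv (mul (inv q.1) q.2 hc)) hc' = q.1 := by
      have h1 := mul_inv_mul q.2 q.1 ((d_inv _).trans (hc.symm.trans (d_inv _)))
      simp only [inv_mul, inv_inv']
      exact h1
    rw [← h]
    refine mem_prodSet _ hΦ ?_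
    rwa [Set.mem_preimage, inv_inv']
  -- Replacing the kernel by a continuous compactly supported function on `G × G` permits Fubini
  -- although `ν x` is not assumed σ-finite.
  obtain ⟨g, hg⟩ := exists_extension_of_closed hS (hK.prod hL)
    (φ := fun q : G × G => (φ q.1 q.2 : ℂ)) (Complex.continuous_ofReal.comp_continuousOn hφc)
    (fun q hq hk => by rw [hφ0 q hq hk, Complex.ofReal_zero])
  set F : G → G → ℝ := fun η ζ => (g (η, ζ)).re
  have hF : ∀ η ζ, r η = (x : G) → r ζ = (x : G) → F η ζ = φ η ζ := fun η ζ h1 h2 => by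
    simp only [F]
    rw [hg (η, ζ) ⟨h1, h2⟩, Complex.ofReal_re]
  have hFc : Continuous F.uncurry := Complex.continuous_re.comp g.continuous
  have hFs : HasCompactSupport F.uncurry := g.hasCompactSupport.comp_left Complex.zero_re
  have hFint : Integrable (fun η => ∫ ζ, F η ζ ∂ν.ν x) (ν.ν x) := by
    have hF0 : ∀ η ζ, η ∉ Prod.fst '' tsupport F.uncurry ∨ ζ ∉ Prod.snd '' tsupport F.uncurry →
        F η ζ = 0 := by
      intro η ζ h
      refine image_eq_zero_of_notMem_tsupport (f := F.uncurry) (x := (η, ζ)) fun hm => ?_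
      rcases h with h | h
      · exact h ⟨_, hm, rfl⟩
      · exact h ⟨_, hm, rfl⟩
    have hc : Continuous fun η => ∫ ζ, F η ζ ∂ν.ν x := by
      rw [← continuousOn_univ]
      exact continuousOn_integral_of_compact_support (hFs.isCompact.image continuous_snd)
        hFc.continuousOn fun η ζ _ hζ => hF0 η ζ (Or.inr hζ)
    exact hc.integrable_of_hasCompactSupport
      (HasCompactSupport.intro (hFs.isCompact.image continuous_fst) fun η hη => by
        simp [hF0 η _ (Or.inl hη)])
  have hB := ν.bddAbove_integral_sq Φ
  -- Schur test: the pointwise Cauchy–Schwarz bound gives one factor `‖f‖_I`; after exchanging the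
  -- integrals, integration over `η` gives the other.
  calc ∫ η, ‖ν.conv f Φ (inv η)‖ ^ 2 ∂ν.ν x
      ≤ ∫ η, ν.normI f * ∫ ζ, F η ζ ∂ν.ν x ∂ν.ν x := by
        refine integral_mono_of_nonneg (Eventually.of_forall fun _ => by positivity)
          (hFint.const_mul _) ?_
        filter_upwards [ν.ae_mem_fibre x] with η hη
        refine (ν.norm_conv_inv_sq_le f Φ η).trans_eq ?_
        rw [rangeUnit_eq hη]
        congr 1
        refine integral_congr_ae ?_
        filter_upwards [ν.ae_mem_fibre x] with ζ hζ using (hF η ζ hη hζ).symm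
    _ = ν.normI f * ∫ ζ, ∫ η, F η ζ ∂ν.ν x ∂ν.ν x := by
        rw [integral_const_mul, integral_integral_swap_of_hasCompactSupport hFc hFs]
    _ ≤ ν.normI f * ∫ ζ, ν.normI f * ‖Φ (inv ζ)‖ ^ 2 ∂ν.ν x := by
        refine mul_le_mul_of_nonneg_left ?_ (ν.normI_nonneg f)
        have h : ∀ᵐ ζ ∂ν.ν x, ∫ η, F η ζ ∂ν.ν x =
            (∫ η, ‖evalMul f (inv η) ζ‖ ∂ν.ν x) * ‖Φ (inv ζ)‖ ^ 2 := by
          filter_upwards [ν.ae_mem_fibre x] with ζ hζ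
          rw [← integral_mul_const]
          refine integral_congr_ae ?_
          filter_upwards [ν.ae_mem_fibre x] with η hη using hF η ζ hη hζ
        refine integral_mono_of_nonneg ?_ ?_ ?_
        · filter_upwards [h] with ζ hζ
          rw [hζ]
          exact mul_nonneg (integral_nonneg fun _ => norm_nonneg _) (by positivity)
        · refine Integrable.const_mul ?_ _
          refine ν.integrable_of_continuousOn hL
            ((continuous_comp_inv Φ).norm.pow 2).continuousOn fun ζ _ hζ => ?_
          have : Φ (inv ζ) = 0 := image_eq_zero_of_notMem_tsupport hζ
          simp [this]
        · filter_upwards [h, ν.ae_mem_fibre x] with ζ hζ hr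
          rw [hζ]
          have := ν.integral_norm_evalMul_inv_le f ζ
          rw [rangeUnit_eq hr] at this
          gcongr
    _ = ν.normI f ^ 2 * ∫ ζ, ‖Φ (inv ζ)‖ ^ 2 ∂ν.ν x := by
        rw [integral_const_mul]
        ring
    _ ≤ _ := by
        gcongr
        exact le_ciSup hB x

theorem HaarSystem.normL2_conv_le : ν.normL2 (ν.conv f Φ) ≤ ν.normI f * ν.normL2 Φ := by
  have h0 : 0 ≤ ⨆ x, ∫ ξ, ‖Φ (inv ξ)‖ ^ 2 ∂ν.ν x :=
    Real.iSup_nonneg fun _ => integral_nonneg fun _ => by positivity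
  refine Real.sqrt_le_iff.mpr ⟨mul_nonneg (ν.normI_nonneg f) (Real.sqrt_nonneg _), ?_⟩
  rw [mul_pow, normL2, Real.sq_sqrt h0]
  exact Real.iSup_le (fun x => ν.integral_norm_conv_sq_le f Φ x) (by positivity)

theorem HaarSystem.reducedNorm_nonneg : 0 ≤ ν.reducedNorm f := by
  refine Real.sSup_nonneg ?_
  rintro _ ⟨Φ, -, rfl⟩
  exact Real.sqrt_nonneg _

theorem HaarSystem.reducedNorm_le_normI : ν.reducedNorm f ≤ ν.normI f := by
  refine Real.sSup_le ?_ (ν.normI_nonneg f)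
  rintro _ ⟨Φ, hΦ, rfl⟩
  exact (ν.normL2_conv_le f Φ).trans (mul_le_of_le_one_right (ν.normI_nonneg f) hΦ)

theorem HaarSystem.reduced_le_normI : ν.reduced f ≤ ν.normI f :=
  (greatestSeminorm_le ν.reducedNorm_nonneg f).trans (ν.reducedNorm_le_normI f)

end Reduced

/-! ## Phase multiplication as an isometric flow -/

section PhaseFlow

variable {G : Type u} [TopologicalSpace G] [T2Space G] [LocallyCompactSpace G]
  [MeasurableSpace G] [BorelSpace G] [TopologicalGroupoid G] (ν : HaarSystem G) (c : Cocycle G)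

theorem HaarSystem.normI_phase (t : ℝ) (f : C_c(G, ℂ)) : ν.normI (c.phase t f) = ν.normI f := by
  simp only [normI, c.norm_phase]

theorem HaarSystem.normL2_phase (t : ℝ) (Φ : C_c(G, ℂ)) : ν.normL2 (c.phase t Φ) = ν.normL2 Φ := by
  simp only [normL2, c.norm_phase]

variable {ν} in
/-- Admissible representations can be twisted by the phase multiplication. -/
theorem HaarSystem.IsAdmissible.comp_phase {K : Type u} [NormedAddCommGroup K]
    [InnerProductSpace ℂ K] [CompleteSpace K] {π : C_c(G, ℂ) →ₗ[ℂ] (K →L[ℂ] K)}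
    (hπ : ν.IsAdmissible π) (t : ℝ) : ν.IsAdmissible (π ∘ₗ (c.phaseEquiv t).toLinearMap) where
  map_conv f g := by
    change π (c.phase t (ν.conv f g)) = π (c.phase t f) * π (c.phase t g)
    rw [← ν.conv_phase, hπ.map_conv]
  map_invol f := by
    change π (c.phase t (invol f)) = ContinuousLinearMap.adjoint (π (c.phase t f))
    rw [← c.invol_phase, hπ.map_invol]
  weakly_continuous C hC k l := by
    obtain ⟨M, hM⟩ := hπ.weakly_continuous C hC k l
    refine ⟨M, fun f hf s hs => hM (c.phase t f) ((c.tsupport_phase_subset t f).trans hf) s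
      fun ξ => ?_⟩
    rw [c.norm_phase]
    exact hs ξ
  norm_le f := (hπ.norm_le (c.phase t f)).trans_eq (ν.normI_phase c t f)

/-- Each `‖π(e^{itc}f)‖` is the norm of `f` in the twisted, still admissible, representation. -/
theorem HaarSystem.full_phase_le (t : ℝ) (f : C_c(G, ℂ)) : ν.full (c.phase t f) ≤ ν.full f := by
  refine Real.sSup_le ?_ (ν.fullNorm_nonneg f)
  rintro x ⟨K, i1, i2, i3, π, hπ, rfl⟩
  exact ν.norm_le_fullNorm (hπ.comp_phase c t) f

theorem HaarSystem.full_phase (t : ℝ) (f : C_c(G, ℂ)) : ν.full (c.phase t f) = ν.full f := by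
  refine le_antisymm (ν.full_phase_le c t f) ?_
  have := ν.full_phase_le c (-t) (c.phase t f)
  rwa [← c.phase_add, neg_add_cancel, c.phase_zero] at this

/-- Convolution by `e^{itc}f` is convolution by `f` conjugated by the `L²`-isometry `Φ ↦ e^{itc}Φ`,
so both suprema run over the same set of values. -/
theorem HaarSystem.reducedNorm_phase (t : ℝ) (f : C_c(G, ℂ)) :
    ν.reducedNorm (c.phase t f) = ν.reducedNorm f := by
  unfold reducedNorm
  congr 1
  ext x
  constructor
  · rintro ⟨Φ, hΦ, rfl⟩
    refine ⟨c.phase (-t) Φ, by rwa [ν.normL2_phase], ?_⟩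
    rw [← ν.normL2_phase c t (ν.conv f _), ← ν.conv_phase, ← c.phase_add t (-t), add_neg_cancel,
      c.phase_zero]
  · rintro ⟨Φ, hΦ, rfl⟩
    refine ⟨c.phase t Φ, by rwa [ν.normL2_phase], ?_⟩
    rw [ν.conv_phase, ν.normL2_phase]

theorem HaarSystem.reduced_phase (t : ℝ) (f : C_c(G, ℂ)) :
    ν.reduced (c.phase t f) = ν.reduced f :=
  greatestSeminorm_comp ν.reducedNorm_nonneg (c.phaseEquiv t) (ν.reducedNorm_phase c t) f

/-- Phase multiplication is a flow for every invariant seminorm dominated by the `I`-norm. -/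
theorem HaarSystem.isIsometricFlow_phase {p : Seminorm ℂ C_c(G, ℂ)} (hp : ∀ f, p f ≤ ν.normI f)
    (hc : ∀ t f, p (c.phase t f) = p f) : p.IsIsometricFlow c.phaseEquiv where
  zero := c.phase_zero
  add := c.phase_add
  isometry := hc
  continuous f s := by
    obtain ⟨M, hM0, hM⟩ := c.exists_norm_phase_sub_le f
    obtain ⟨C, hC0, hC⟩ := ν.exists_normI_le f.hasCompactSupport.isCompact
    have hlim : Tendsto (fun t : ℝ => C * (|t - s| * M)) (𝓝 s) (𝓝 0) := by
      have : Continuous fun t : ℝ => C * (|t - s| * M) := by fun_prop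
      simpa using this.tendsto s
    refine squeeze_zero (fun t => apply_nonneg p _) (fun t => ?_) hlim
    exact (hp _).trans (hC _ _ (by positivity) (fun ξ hξ => c.phase_sub_eq_zero hξ s t) (hM s t))

variable {c} (lam : HaarSystem c.Ker) {pH : Seminorm ℂ C_c(c.Ker, ℂ)}

/-- Phase multiplication is a flow for the norm of the correspondence. -/
theorem HaarSystem.isIsometricFlow_moduleSeminorm (hpH : ∀ h, pH h ≤ lam.normI h) :
    (moduleSeminorm ν pH).IsIsometricFlow c.phaseEquiv where
  zero := c.phase_zero
  add := c.phase_add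
  isometry t := greatestSeminorm_comp (fun _ => Real.sqrt_nonneg _) (c.phaseEquiv t) fun Φ => by
    rw [c.phaseEquiv_apply, ν.innerKer_phase]
  continuous f s := by
    obtain ⟨M, hM0, hM⟩ := c.exists_norm_phase_sub_le f
    have hK := f.hasCompactSupport.isCompact
    have hK' := isCompact_preimage_inv hK
    obtain ⟨A, hA0, hA⟩ := ν.exists_norm_conv_le hK'
    -- All the inner products `⟨Ψ, Ψ⟩` of differences along the orbit of `f` are supported in the
    -- compact set `ker c ∩ K⁻¹K`, with `K` the support of `f`.
    obtain ⟨C, hC0, hC⟩ := lam.exists_normI_le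
      (c.isClosedEmbedding_incl.isCompact_preimage (isCompact_prodSet hK' hK))
    have hlim : Tendsto (fun t : ℝ => √(C * (A * ((|t - s| * M) * (|t - s| * M))))) (𝓝 s) (𝓝 0) := by
      have : Continuous fun t : ℝ => √(C * (A * ((|t - s| * M) * (|t - s| * M)))) := by fun_prop
      simpa using this.tendsto s
    refine squeeze_zero (fun t => apply_nonneg _ _) (fun t => ?_) hlim
    refine (greatestSeminorm_le (fun _ => Real.sqrt_nonneg _) _).trans (Real.sqrt_le_sqrt ?_)
    set Ψ := c.phase t f - c.phase s f
    have hΨ : ∀ ξ, ξ ∉ tsupport f → Ψ ξ = 0 := fun ξ hξ => c.phase_sub_eq_zero hξ s t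
    have hinv : ∀ ξ, ξ ∉ inv ⁻¹' tsupport f → invol Ψ ξ = 0 := fun ξ hξ => by
      change starRingEnd ℂ (Ψ (inv ξ)) = 0
      rw [hΨ _ hξ, map_zero]
    refine (hpH _).trans (hC _ _ (by positivity) (fun χ hχ => ?_) fun χ => ?_)
    · exact ν.conv_eq_zero (invol Ψ) Ψ hinv hΨ hχ
    · refine hA (invol Ψ) Ψ _ _ (by positivity) hinv (fun ξ => ?_) (hM s t) (c.incl χ)
      exact (RCLike.norm_conj (Ψ (inv ξ))).trans_le (hM s t (inv ξ))

/-- The flows on the completed algebra and on the correspondence obtained from phase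
multiplication, for `C*`-norms dominated by the `I`-norms. -/
theorem HaarSystem.exists_phase_groups {p : Seminorm ℂ C_c(G, ℂ)} (hp : ∀ f, p f ≤ ν.normI f)
    (hc : ∀ t f, p (c.phase t f) = p f) (hpH : ∀ h, pH h ≤ lam.normI h) :
    ∃ (u : ℝ → ν.Alg p →L[ℂ] ν.Alg p)
      (U : ℝ → CorrModule ν lam pH →L[ℂ] CorrModule ν lam pH),
      ν.IsAutomorphismGroup p u ∧
      (∀ t f, u t (ν.toAlg p f) = ν.toAlg p (c.phase t f)) ∧
      CorrModule.IsUnitaryGroup U ∧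
      (∀ t f, U t (CorrModule.of ν lam pH f) = CorrModule.of ν lam pH (c.phase t f)) ∧
      CorrModule.Implements U u := by
  have hu := ν.isIsometricFlow_phase c hp hc
  have hU := ν.isIsometricFlow_moduleSeminorm lam hpH
  let e : ℝ → C_c(G, ℂ) ≃ C_c(G, ℂ) := fun t => (c.phaseEquiv t).toEquiv
  refine ⟨fun t => (hu.extend t).toContinuousLinearEquiv.toContinuousLinearMap,
    fun t => (hU.extend t).toContinuousLinearEquiv.toContinuousLinearMap,
    ⟨hu.extend_zero, hu.extend_add, fun t a b => ?_, fun t a => ?_, hu.continuous_extend⟩,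
    hu.extend_toCompletion,
    ⟨hU.extend_zero, hU.extend_add,
      fun t => ⟨fun a b => ?_, hU.extend_apply_neg t, hU.extend_neg_apply t⟩,
      fun t a b => ?_, hU.continuous_extend⟩,
    hU.extend_toCompletion, fun t a b => ?_⟩
  · exact (limitExtension₂_equivariant (e₁ := e t) (e₂ := e t) (e₃ := e t)
      (hu.extend t) (hu.extend t) (hu.extend t) (hu.extend_toCompletion t)
      (hu.extend_toCompletion t) (hu.extend_toCompletion t) (ν.conv_phase c t) a b).symm
  · exact (limitExtension_equivariant (denseRange_toCompletion p) (e t)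
      (hu.extend t).toHomeomorph (hu.extend t).toHomeomorph (map_zero (hu.extend t))
      (fun f => (hu.extend_toCompletion t f).symm)
      (fun f => (congrArg (toCompletion p) (c.invol_phase t f)).trans
        (hu.extend_toCompletion t (invol f)).symm) a).symm
  -- Invariance of the inner product, applied to `a` and `U_{-t} b`, is the adjoint relation for
  -- `U_t`.
  · have h := limitExtension₂_equivariant (e₁ := e t) (e₂ := e t) (e₃ := id)
      (hU.extend t) (hU.extend t) (LinearIsometryEquiv.refl ℂ (SeminormCompletion pH))
      (hU.extend_toCompletion t) (hU.extend_toCompletion t) (fun _ => rfl)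
      (ν.innerKer_phase c t) a (hU.extend (-t) b)
    exact (congrArg (limitExtension₂ _ _ pH (ν.innerKer c) (hU.extend t a))
      (hU.extend_neg_apply t b)).symm.trans h
  · exact (limitExtension₂_equivariant (e₁ := e t) (e₂ := Equiv.refl _) (e₃ := e t)
      (hU.extend t) (LinearIsometryEquiv.refl ℂ (SeminormCompletion pH)) (hU.extend t)
      (hU.extend_toCompletion t) (fun _ => rfl) (hU.extend_toCompletion t)
      (lam.rightAct_phase t) a b).symm
  -- Covariance `U_t(a·e) = u_t(a)·U_t e`, taken at `e = U_{-t} b`, is the implementation identity.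
  · have h := limitExtension₂_equivariant (e₁ := e t) (e₂ := e t) (e₃ := e t)
      (hu.extend t) (hU.extend t) (hU.extend t) (hu.extend_toCompletion t)
      (hU.extend_toCompletion t) (hU.extend_toCompletion t) (ν.conv_phase c t) a
      (hU.extend (-t) b)
    exact h.symm.trans (congrArg (limitExtension₂ p _ _ ν.conv (hu.extend t a))
      (hU.extend_neg_apply t b))

end PhaseFlow

theorem proposition3p5 {G : Type u} [TopologicalSpace G] [T2Space G] [LocallyCompactSpace G]
    [MeasurableSpace G] [BorelSpace G] [TopologicalGroupoid G] (ν : HaarSystem G)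
    (c : Cocycle G) (lam : HaarSystem c.Ker) :
    (∃ (u : ℝ → ν.Alg ν.full →L[ℂ] ν.Alg ν.full)
        (U : ℝ → CorrModule ν lam lam.full →L[ℂ] CorrModule ν lam lam.full),
      ν.IsAutomorphismGroup ν.full u ∧
      (∀ t f, u t (ν.toAlg ν.full f) = ν.toAlg ν.full (c.phase t f)) ∧
      CorrModule.IsUnitaryGroup U ∧
      (∀ t f, U t (CorrModule.of ν lam lam.full f) =
        CorrModule.of ν lam lam.full (c.phase t f)) ∧
      CorrModule.Implements U u) ∧
    (∃ (u : ℝ → ν.Alg ν.reduced →L[ℂ] ν.Alg ν.reduced)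
        (U : ℝ → CorrModule ν lam lam.reduced →L[ℂ] CorrModule ν lam lam.reduced),
      ν.IsAutomorphismGroup ν.reduced u ∧
      (∀ t f, u t (ν.toAlg ν.reduced f) = ν.toAlg ν.reduced (c.phase t f)) ∧
      CorrModule.IsUnitaryGroup U ∧
      (∀ t f, U t (CorrModule.of ν lam lam.reduced f) =
        CorrModule.of ν lam lam.reduced (c.phase t f)) ∧
      CorrModule.Implements U u) :=
  ⟨ν.exists_phase_groups lam ν.full_le_normI (ν.full_phase c) lam.full_le_normI,
    ν.exists_phase_groups lam ν.reduced_le_normI (ν.reduced_phase c) lam.reduced_le_normI⟩
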